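/- Let $L=\bigoplus_{n\in\mathbb Z}L_n$ be a $\mathbb Z$-graded complex Lie algebra with $\dim L_n<\infty$, let $L^*=\bigoplus_n L^*_n$, $L_n^*=\mathrm{Hom}(L_{-n},\mathbb C)$, be its restricted dual, and let $(e_i)$ be a homogeneous basis of $L$, $e_i\in L_{\deg i}$, indexed by a linearly ordered set along which the degree does not decrease (for instance by $\mathbb Z$, with $e_i\in L_{\le 0}$ if and only if $i\le 0$), with dual basis $(e_i^*)$. Let $cl(L)=\iota(L)\oplus\varepsilon(L^*)\oplus\mathbb C K$ be the graded Lie superalgebra with $\iota(L)\oplus\varepsilon(L^*)$ odd, $K$ even and central, $[\iota(x),\varepsilon(u)]=\langle u,x\rangle K$ and $[\iota(x),\iota(y)]=[\varepsilon(u),\varepsilon(v)]=0$. For a graded Lie superalgebra $S$ containing an even central element $K$ of degree $0$, let $U(S)^{com}$ be the completion of $U(S)$ with respect to the left ideals generated by the homogeneous elements of degree $\ge N$, $N\in\mathbb Z$, and let $U_1(S)^{com}=U(S)^{com}/(K-1)$. Let $\Lambda^{\infty/2+\bullet}L^*$ be the space of semi-infinite forms, i.e. the span of the monomials $e_{i_1}^*\wedge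 e_{i_2}^*\wedge\cdots$, $i_1>i_2>\cdots$, whose index set differs from $\{i\mid \deg i\le 0\}$ by finitely many elements; $\varepsilon(u)$ acts on it by the wedge product with $u$, $\iota(x)$ by contraction and $K$ by the identity, and this action extends to $U_1(cl(L))^{com}$. For $\beta\in L_0^*$ and $x\in L$ put $$\rho^\beta(x)=\sum_i :\!\iota([x,e_i])\,\varepsilon(e_i^*)\!:+\,\beta(x),$$ where $:\!\iota(e_i)\varepsilon(e_j^*)\!:$ is $-\varepsilon(e_j^*)\iota(e_i)$ if $i=j$ and $\deg j>0$, and $\iota(e_i)\varepsilon(e_j^*)$ otherwise. Then the series converges in $U(cl(L))^{com}$, and there is an alternating bilinear form $\gamma^\beta:L\times L\to\mathbb C$ with $\gamma^\beta(L_m,L_n)=0$ for $m+n\neq 0$ such that $[\rho^\beta(x),\rho^\beta(y)]-\rho^\beta([x,y])=\gamma^\beta(x,y)$ in $U_1(cl(L))^{com}$ for all $x,y\in L$. Let $F_\beta$ be any graded complement of $\ker\gamma^\beta=\{x\in L\mid\gamma^\beta(x,L)=0\}$ in $L$, let $c(L)=cl(L)\oplus\epsilon(F_\beta)$ be the graded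 Lie superalgebra in which the copy $\epsilon(F_\beta)$ of $F_\beta$ is even, commutes with $cl(L)$ and satisfies $[\epsilon(x),\epsilon(y)]=-\gamma^\beta(x,y)K$ for $x,y\in F_\beta$, and for $x\in L$ let $\epsilon(x)$ denote $\epsilon$ of the projection of $x$ to $F_\beta$ along $\ker\gamma^\beta$. Let $\mathfrak F_\beta$ be the $\epsilon(F_\beta)\oplus\mathbb C K$-module induced from the one-dimensional module of $\bigoplus_{n>0}\epsilon(F_\beta)_n\oplus\mathbb C K$ on which $\epsilon(F_\beta)_n$ acts by $0$ and $K$ by $1$; then $\Lambda^{\infty/2+\bullet}L^*\otimes\mathfrak F_\beta$ is a smooth $c(L)$-module and hence a module over $U_1(c(L))^{com}$. The series defining $\rho^\beta(x)$ also converges in $U(c(L))^{com}$. Put $\bar\rho^\beta(x)=\rho^\beta(x)+\epsilon(x)\in U_1(c(L))^{com}$. If $[L,L]\subseteq\ker\gamma^\beta$, then $x\mapsto\bar\rho^\beta(x)$ is a homomorphism of Lie algebras $L\to U_1(c(L))^{com}$, and $\Lambda^{\infty/2+\bullet}L^*\otimes\mathfrak F_\beta$ is an $L$-module on which each $x\in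 L$ acts by $\bar\rho^\beta(x)$. On the other hand, if $\gamma^\beta$ is not identically zero, then $\Lambda^{\infty/2+\bullet}L^*$ is not an $L$-module under the action of $x\in L$ by $\rho^\beta(x)$. -/

import Mathlib

attribute [local instance 100] LieRing.ofAssociativeRing

noncomputable section

namespace SemiInfinite

/-! ### Graded Lie superalgebras, their enveloping algebras, and completions -/

/-- The Koszul sign `(-1)^(i j)` of two parities. -/
def koszul (i j : ZMod 2) : ℤ := (-1) ^ (i.val * j.val)

/-- A `ℤ`-graded complex Lie superalgebra with underlying vector space `V`: `par 0` and `par 1` are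
the even and the odd part, `gr n` is the part of degree `n`. -/
structure GradedLieSuperalgebra (V : Type*) [AddCommGroup V] [Module ℂ V] where
  par : ZMod 2 → Submodule ℂ V
  gr : ℤ → Submodule ℂ V
  br : V →ₗ[ℂ] V →ₗ[ℂ] V
  isCompl_par : IsCompl (par 0) (par 1)
  internal_gr : DirectSum.IsInternal gr
  gr_le : ∀ n, gr n ≤ (gr n ⊓ par 0) ⊔ (gr n ⊓ par 1)
  br_par : ∀ {i j x y}, x ∈ par i → y ∈ par j → br x y ∈ par (i + j)
  br_gr : ∀ {m n x y}, x ∈ gr m → y ∈ gr n → br x y ∈ gr (m + n)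
  skew : ∀ {i j x y}, x ∈ par i → y ∈ par j → br x y = -(koszul i j • br y x)
  jacobi : ∀ {i j x y} (z), x ∈ par i → y ∈ par j →
    br x (br y z) = br (br x y) z + koszul i j • br y (br x z)

variable {V : Type*} [AddCommGroup V] [Module ℂ V]

/-- The relations `x y - (-1)^(p(x) p(y)) y x = [x, y]` that define the universal enveloping
algebra of a Lie superalgebra as a quotient of the tensor algebra. -/
inductive EnvRel (S : GradedLieSuperalgebra V) : TensorAlgebra ℂ V → TensorAlgebra ℂ V → Prop
  | mk {i j : ZMod 2} {x y : V} (hx : x ∈ S.par i) (hy : y ∈ S.par j) :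
      EnvRel S (TensorAlgebra.ι ℂ x * TensorAlgebra.ι ℂ y)
        (koszul i j • (TensorAlgebra.ι ℂ y * TensorAlgebra.ι ℂ x) + TensorAlgebra.ι ℂ (S.br x y))

/-- The universal enveloping algebra `U(S)` of a Lie superalgebra. -/
def Env (S : GradedLieSuperalgebra V) : Type _ := RingQuot (EnvRel S)

namespace Env

variable (S : GradedLieSuperalgebra V)

instance : Ring (Env S) := inferInstanceAs (Ring (RingQuot (EnvRel S)))

instance : Algebra ℂ (Env S) := inferInstanceAs (Algebra ℂ (RingQuot (EnvRel S)))

/-- The projection from the tensor algebra to `U(S)`. -/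
def proj : TensorAlgebra ℂ V →ₐ[ℂ] Env S := RingQuot.mkAlgHom ℂ (EnvRel S)

/-- The canonical map from `S` to `U(S)`. -/
def of : V →ₗ[ℂ] Env S := (proj S).toLinearMap ∘ₗ TensorAlgebra.ι ℂ

variable {S}

theorem of_mul_of {i j : ZMod 2} {x y : V} (hx : x ∈ S.par i) (hy : y ∈ S.par j) :
    of S x * of S y = koszul i j • (of S y * of S x) + of S (S.br x y) := by
  have h := RingQuot.mkAlgHom_rel ℂ (EnvRel.mk hx hy)
  simp only [map_mul, map_add, map_zsmul] at h
  exact h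

/-- A linear map that respects the superbracket extends to `U(S)`. -/
def lift {A : Type*} [Ring A] [Algebra ℂ A] (f : V →ₗ[ℂ] A)
    (hf : ∀ {i j x y}, x ∈ S.par i → y ∈ S.par j →
      f x * f y = koszul i j • (f y * f x) + f (S.br x y)) : Env S →ₐ[ℂ] A :=
  RingQuot.liftAlgHom ℂ ⟨TensorAlgebra.lift ℂ f, by
    rintro _ _ ⟨hx, hy⟩
    simp only [map_mul, map_add, map_zsmul, TensorAlgebra.lift_ι_apply]
    exact hf hx hy⟩

theorem lift_of {A : Type*} [Ring A] [Algebra ℂ A] (f : V →ₗ[ℂ] A)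
    (hf : ∀ {i j x y}, x ∈ S.par i → y ∈ S.par j →
      f x * f y = koszul i j • (f y * f x) + f (S.br x y)) (x : V) :
    lift f hf (of S x) = f x := by
  have h : lift f hf (proj S (TensorAlgebra.ι ℂ x)) = f x := by
    unfold lift proj
    erw [RingQuot.liftAlgHom_mkAlgHom_apply]
    simp
  exact h

variable (S) in
/-- `IsMonomial S k n u`: `u` is a product of `k` homogeneous elements of `S` (for the parity and
the degree) whose degrees add up to `n`. -/
inductive IsMonomial : ℕ → ℤ → Env S → Prop
  | one : IsMonomial 0 0 1
  | mul {i : ZMod 2} {d : ℤ} {x : V} {k : ℕ} {n : ℤ} {u : Env S} (hp : x ∈ S.par i)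
      (hd : x ∈ S.gr d) (hu : IsMonomial k n u) : IsMonomial (k + 1) (d + n) (of S x * u)

variable (S) in
/-- The component `U(S)_n` of degree `n`. -/
def degree (n : ℤ) : Submodule ℂ (Env S) :=
  Submodule.span ℂ {u | ∃ k, IsMonomial S k n u}

theorem IsMonomial.mul_mem {k n u} (h : IsMonomial S k n u) {l m w} (h' : IsMonomial S l m w) :
    ∃ j, IsMonomial S j (n + m) (u * w) := by
  induction h with
  | one => exact ⟨l, by simpa using h'⟩
  | mul hp hd _ ih =>
    obtain ⟨j, hj⟩ := ih
    exact ⟨j + 1, by simpa [mul_assoc, add_assoc] using IsMonomial.mul hp hd hj⟩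

theorem degree_mul {m n : ℤ} {u w : Env S} (hu : u ∈ degree S m) (hw : w ∈ degree S n) :
    u * w ∈ degree S (m + n) := by
  have : degree S m * degree S n ≤ degree S (m + n) := by
    rw [degree, degree, Submodule.span_mul_span, Submodule.span_le]
    rintro _ ⟨a, ⟨k, ha⟩, b, ⟨l, hb⟩, rfl⟩
    exact Submodule.subset_span (ha.mul_mem hb)
  exact this (Submodule.mul_mem_mul hu hw)

theorem gr_induction {p : V → Prop} (zero : p 0) (add : ∀ x y, p x → p y → p (x + y))
    (hom : ∀ (i : ZMod 2) (n : ℤ) (x : V), x ∈ S.par i → x ∈ S.gr n → p x) (x : V) : p x := by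
  have hx : x ∈ ⨆ n, S.gr n := by
    rw [S.internal_gr.submodule_iSup_eq_top]; trivial
  induction hx using Submodule.iSup_induction' with
  | mem n x hx =>
    obtain ⟨a, ha, b, hb, rfl⟩ := Submodule.mem_sup.1 (S.gr_le n hx)
    exact add _ _ (hom 0 n a ha.2 ha.1) (hom 1 n b hb.2 hb.1)
  | zero => exact zero
  | add x y _ _ hx hy => exact add _ _ hx hy

theorem env_induction {p : Env S → Prop} (zero : p 0) (add : ∀ a b, p a → p b → p (a + b))
    (smul : ∀ (c : ℂ) a, p a → p (c • a)) (one : p 1)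
    (mul : ∀ (i : ZMod 2) (n : ℤ) (x : V) (a : Env S), x ∈ S.par i → x ∈ S.gr n → p a →
      p (of S x * a)) (a : Env S) : p a := by
  suffices h : ∀ (t : TensorAlgebra ℂ V) (b : Env S), p b →
      p (proj S t * b) by
    obtain ⟨t, ht⟩ := RingQuot.mkAlgHom_surjective ℂ (EnvRel S) a
    have := h t 1 one
    rw [mul_one] at this
    exact ht ▸ this
  intro t
  induction t using TensorAlgebra.induction with
  | algebraMap r =>
    intro b hb
    rw [AlgHom.commutes, ← Algebra.smul_def]
    exact smul r b hb
  | ι x =>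
    intro b hb
    exact gr_induction (S := S) (p := fun x => p (of S x * b)) (by simpa using zero)
      (fun x y hx hy => by simpa [add_mul] using add _ _ hx hy)
      (fun i n x hx hx' => mul i n x b hx hx' hb) x
  | mul s t hs ht =>
    intro b hb
    rw [map_mul, mul_assoc]
    exact hs _ (ht b hb)
  | add s t hs ht =>
    intro b hb
    rw [map_add, add_mul]
    exact add _ _ (hs b hb) (ht b hb)

variable (S) in
/-- The left ideal of `U(S)` generated by the homogeneous elements of degree at least `N`.
Since `U(S)_n = ⨁ k ≥ n, U(S_{≤ 0})_{n - k} U(S_+)_k`, it consists of the finite sums `∑ u_i v_i`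
with `u_i ∈ U(S_{≤ 0})` and `v_i ∈ U(S_+)` homogeneous of degree at least `N`. -/
def tail (N : ℤ) : Submodule (Env S) (Env S) :=
  Submodule.span (Env S) {u | ∃ n, N ≤ n ∧ u ∈ degree S n}

theorem tail_antitone {M N : ℤ} (h : M ≤ N) : tail S N ≤ tail S M :=
  Submodule.span_mono fun _ ⟨n, hn, hu⟩ => ⟨n, h.trans hn, hu⟩

theorem tail_mul (a : Env S) : ∀ N : ℤ, ∃ M, ∀ b ∈ tail S M, b * a ∈ tail S N := by
  induction a using env_induction with
  | zero => exact fun N => ⟨N, fun b _ => by simp⟩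
  | add a a' ha ha' =>
    intro N
    obtain ⟨M, hM⟩ := ha N
    obtain ⟨M', hM'⟩ := ha' N
    refine ⟨max M M', fun b hb => ?_⟩
    rw [mul_add]
    exact add_mem (hM b (tail_antitone (le_max_left _ _) hb))
      (hM' b (tail_antitone (le_max_right _ _) hb))
  | smul c a ha =>
    intro N
    obtain ⟨M, hM⟩ := ha N
    refine ⟨M, fun b hb => ?_⟩
    rw [mul_smul_comm, Algebra.smul_def]
    exact Submodule.smul_mem _ _ (hM b hb)
  | one => exact fun N => ⟨N, fun b hb => by simpa using hb⟩
  | mul i d x a hx hx' ha =>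
    intro N
    obtain ⟨M, hM⟩ := ha N
    refine ⟨M - d, fun b hb => ?_⟩
    rw [← mul_assoc]
    refine hM _ ?_
    have hx1 : of S x ∈ degree S d :=
      Submodule.subset_span ⟨1, by simpa using IsMonomial.mul hx hx' IsMonomial.one⟩
    induction hb using Submodule.span_induction with
    | mem b hb =>
      obtain ⟨n, hn, hb⟩ := hb
      exact Submodule.subset_span ⟨n + d, by linarith, degree_mul hb hx1⟩
    | zero => simp
    | add b c _ _ hb hc => rw [add_mul]; exact add_mem hb hc
    | smul r b _ hb => rw [smul_eq_mul, mul_assoc]; exact Submodule.smul_mem _ _ hb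

theorem tail_basis : RingSubgroupsBasis fun N : ℤ => (tail S N).toAddSubgroup where
  inter i j := ⟨max i j, le_inf (tail_antitone (le_max_left _ _))
    (tail_antitone (le_max_right _ _))⟩
  mul i := ⟨i, by
    rintro _ ⟨a, _, b, hb, rfl⟩
    exact Submodule.smul_mem _ a hb⟩
  leftMul x i := ⟨i, fun b hb => Submodule.smul_mem _ x hb⟩
  rightMul x i := tail_mul x i

/-- The linear topology on `U(S)` in which the left ideals `tail S N` are a basis of neighbourhoods
of zero. -/
instance : TopologicalSpace (Env S) := tail_basis.topology

instance : IsTopologicalRing (Env S) :=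
  tail_basis.toRingFilterBasis.isTopologicalRing

instance : UniformSpace (Env S) := IsTopologicalAddGroup.rightUniformSpace (Env S)

instance : IsUniformAddGroup (Env S) := isUniformAddGroup_of_addCommGroup

instance : UniformContinuousConstSMul ℂ (Env S) where
  uniformContinuous_const_smul c :=
    uniformContinuous_addMonoidHom_of_continuous (f := DistribSMul.toAddMonoidHom (Env S) c) (by
      have : (fun a : Env S => c • a) = fun a => algebraMap ℂ (Env S) c * a := by
        funext a; rw [Algebra.smul_def]
      change Continuous fun a : Env S => c • a
      rw [this]
      exact continuous_const_mul _)

theorem continuous_of_tail {M : Type*} [AddCommGroup M] [TopologicalSpace M]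
    [IsTopologicalAddGroup M] (f : Env S →+ M) {N : ℤ} (h : ∀ a ∈ tail S N, f a = 0) :
    Continuous f := by
  refine continuous_of_continuousAt_zero f ?_
  rw [ContinuousAt, map_zero]
  refine tendsto_nhds_of_eventually_eq ?_
  exact (tail_basis.hasBasis_nhds_zero.mem_of_mem (i := N) trivial : _) |> Filter.mem_of_superset <| h

end Env

/-- The completion `U(S)^com`: the infinite sums `∑ u_i v_i` with `u_i ∈ U(S_{≤ 0})` and
`v_i ∈ U(S_+)` in which only finitely many `v_i` have degree less than any given `N`. -/
abbrev EnvCom (S : GradedLieSuperalgebra V) : Type _ := UniformSpace.Completion (Env S)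

/-- The canonical map from `S` to `U(S)^com`. -/
def EnvCom.of (S : GradedLieSuperalgebra V) : V →ₗ[ℂ] EnvCom S where
  toFun x := (Env.of S x : EnvCom S)
  map_add' x y := by rw [map_add, UniformSpace.Completion.coe_add]
  map_smul' c x := by rw [map_smul, UniformSpace.Completion.coe_smul]; rfl

/-- The quotient `U_1(S)^com = U(S)^com / (K - 1)`, for an element `K` of `S`. -/
abbrev EnvOne (S : GradedLieSuperalgebra V) (K : V) : Type _ :=
  RingQuot fun a b : EnvCom S => a = EnvCom.of S K ∧ b = 1

/-- The projection from `U(S)^com` to `U_1(S)^com`. -/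
def EnvOne.mk (S : GradedLieSuperalgebra V) (K : V) : EnvCom S →ₐ[ℂ] EnvOne S K :=
  RingQuot.mkAlgHom ℂ _

section Smooth

variable {S : GradedLieSuperalgebra V} {M : Type*} [AddCommGroup M] [Module ℂ M]

/-- A representation of `U(S)` is smooth if every vector is killed by `U(S)_n` for all large `n`. -/
def IsSmooth (φ : Env S →ₐ[ℂ] Module.End ℂ M) : Prop :=
  ∀ m : M, ∃ N : ℤ, ∀ n, N ≤ n → ∀ u ∈ Env.degree S n, φ u m = 0

theorem IsSmooth.tail {φ : Env S →ₐ[ℂ] Module.End ℂ M} (h : IsSmooth φ) (m : M) :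
    ∃ N : ℤ, ∀ a ∈ Env.tail S N, φ a m = 0 := by
  obtain ⟨N, hN⟩ := h m
  refine ⟨N, fun a ha => ?_⟩
  induction ha using Submodule.span_induction with
  | mem b hb => obtain ⟨n, hn, hb⟩ := hb; exact hN n hn b hb
  | zero => simp
  | add b c _ _ hb hc => simp [hb, hc]
  | smul r b _ hb => simp [hb]

/-- The action of `U(S)^com` on a vector of a smooth module: the extension of `a ↦ a m` by
continuity, for the discrete topology on the module. -/
def IsSmooth.evalCom {φ : Env S →ₐ[ℂ] Module.End ℂ M} (h : IsSmooth φ) (m : M) :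
    EnvCom S →+ M :=
  letI : UniformSpace M := ⊥
  haveI : DiscreteUniformity M := ⟨rfl⟩
  haveI : IsUniformAddGroup M := inferInstance
  AddMonoidHom.extension (((LinearMap.applyₗ m).comp φ.toLinearMap).toAddMonoidHom) (by
    obtain ⟨N, hN⟩ := h.tail m
    exact Env.continuous_of_tail _ hN)

theorem IsSmooth.evalCom_coe {φ : Env S →ₐ[ℂ] Module.End ℂ M} (h : IsSmooth φ) (m : M)
    (a : Env S) : h.evalCom m (a : EnvCom S) = φ a m := by
  let : UniformSpace M := ⊥
  have : DiscreteUniformity M := ⟨rfl⟩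
  have : IsUniformAddGroup M := inferInstance
  exact AddMonoidHom.extension_coe _ _ a

theorem IsSmooth.continuous_evalCom {φ : Env S →ₐ[ℂ] Module.End ℂ M} (h : IsSmooth φ) (m : M) :
    @Continuous _ _ _ (⊥ : TopologicalSpace M) (h.evalCom m) := by
  let : UniformSpace M := ⊥
  have : DiscreteUniformity M := ⟨rfl⟩
  have : IsUniformAddGroup M := inferInstance
  exact AddMonoidHom.continuous_extension _ _

/-- The action of `U(S)^com` on a smooth module. -/
def IsSmooth.com {φ : Env S →ₐ[ℂ] Module.End ℂ M} (h : IsSmooth φ) :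
    EnvCom S →ₐ[ℂ] Module.End ℂ M :=
  letI : TopologicalSpace M := ⊥
  haveI : DiscreteTopology M := ⟨rfl⟩
  have hc : ∀ m, Continuous (h.evalCom m) := h.continuous_evalCom
  AlgHom.ofLinearMap
    { toFun := fun a =>
        { toFun := fun m => h.evalCom m a
          map_add' := fun m m' => by
            induction a using UniformSpace.Completion.induction_on with
            | hp => exact isClosed_eq (hc _) ((hc _).add (hc _))
            | ih a => simp only [h.evalCom_coe, map_add]
          map_smul' := fun c m => by
            induction a using UniformSpace.Completion.induction_on with
            | hp => exact isClosed_eq (hc _) (continuous_of_discreteTopology.comp (hc m))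
            | ih a => simp only [h.evalCom_coe, map_smul, RingHom.id_apply] }
      map_add' := fun a b => by ext m; simp
      map_smul' := fun c a => by
        ext m
        change h.evalCom m (c • a) = c • h.evalCom m a
        refine UniformSpace.Completion.induction_on a (isClosed_eq
          ((hc m).comp (continuous_const_smul c)) (continuous_of_discreteTopology.comp (hc m)))
          fun a => ?_
        rw [← UniformSpace.Completion.coe_smul]
        simp only [h.evalCom_coe, map_smul, LinearMap.smul_apply] }
    (by
      ext m
      change h.evalCom m ((1 : Env S) : EnvCom S) = m
      rw [h.evalCom_coe, map_one]; rfl)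
    (by
      intro a b
      ext m
      change h.evalCom m (a * b) = h.evalCom (h.evalCom m b) a
      induction a, b using UniformSpace.Completion.induction_on₂ with
      | hp =>
        refine isClosed_eq ((hc m).comp continuous_mul) ?_
        rw [continuous_iff_continuousAt]
        rintro ⟨a, b⟩
        have h1 : ∀ᶠ p : EnvCom S × EnvCom S in nhds (a, b), h.evalCom m p.2 = h.evalCom m b :=
          (((hc m).comp continuous_snd).tendsto (a, b)).eventually
            ((isOpen_discrete {h.evalCom m b}).mem_nhds rfl)
        refine ContinuousAt.congr (f := fun p : EnvCom S × EnvCom S =>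
          h.evalCom (h.evalCom m b) p.1) ((hc _).comp continuous_fst).continuousAt ?_
        filter_upwards [h1] with p hp
        rw [hp]
      | ih a b =>
        rw [← UniformSpace.Completion.coe_mul]
        simp only [h.evalCom_coe, map_mul, Module.End.mul_apply])

theorem IsSmooth.com_coe {φ : Env S →ₐ[ℂ] Module.End ℂ M} (h : IsSmooth φ) (a : Env S) :
    h.com (a : EnvCom S) = φ a :=
  LinearMap.ext fun m => h.evalCom_coe m a

/-- The action of `U_1(S)^com` on a smooth module on which `K` acts as the identity. -/
def IsSmooth.one {φ : Env S →ₐ[ℂ] Module.End ℂ M} (h : IsSmooth φ) {K : V}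
    (hK : φ (Env.of S K) = 1) : EnvOne S K →ₐ[ℂ] Module.End ℂ M :=
  RingQuot.liftAlgHom ℂ ⟨h.com, by
    rintro _ _ ⟨rfl, rfl⟩
    rw [map_one]
    exact (h.com_coe _).trans hK⟩

/-- Smoothness of a module generated by a vector `v` that is killed by the elements of positive
degree, if all brackets act as scalars. -/
theorem isSmooth_of_vacuum {φ : Env S →ₐ[ℂ] Module.End ℂ M} (c : V → V → ℂ)
    (hbr : ∀ x y, φ (Env.of S (S.br x y)) = c x y • 1)
    (hc : ∀ {m n x y}, x ∈ S.gr m → y ∈ S.gr n → m + n ≠ 0 → c x y = 0) (v : M)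
    (hv : ∀ {n x}, 0 < n → x ∈ S.gr n → φ (Env.of S x) v = 0)
    (hgen : ∀ P : Submodule ℂ M, v ∈ P → (∀ x, ∀ m ∈ P, φ (Env.of S x) m ∈ P) → P = ⊤) :
    IsSmooth φ := by
  let W (k : ℕ) (n : ℤ) : Submodule ℂ M :=
    Submodule.span ℂ {m | ∃ w j, j ≤ k ∧ Env.IsMonomial S j n w ∧ m = φ w v}
  have hW : ∀ {i d x k n u}, x ∈ S.par i → x ∈ S.gr d → 0 < d → Env.IsMonomial S k n u →
      φ (Env.of S x) (φ u v) ∈ W k (d + n) := by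
    intro i d x k n u hx hd hpos hu
    induction hu with
    | one =>
      rw [map_one, Module.End.one_apply, hv hpos hd]
      exact zero_mem _
    | @mul j b y k n u hy hb hu ih =>
      rw [← Module.End.mul_apply, ← map_mul, ← mul_assoc, Env.of_mul_of hx hy, add_mul, map_add,
        LinearMap.add_apply, smul_mul_assoc, map_zsmul, mul_assoc]
      refine add_mem ?_ ?_
      · rw [LinearMap.smul_apply]
        refine zsmul_mem ?_ _
        rw [map_mul, Module.End.mul_apply, map_mul, Module.End.mul_apply]
        have : W k (d + n) ≤ (W (k + 1) (d + (b + n))).comap (φ (Env.of S y)) := by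
          refine Submodule.span_le.2 ?_
          rintro _ ⟨w, l, hl, hw, rfl⟩
          refine Submodule.subset_span ⟨Env.of S y * w, l + 1, by lia, ?_, by simp⟩
          have := Env.IsMonomial.mul hy hb hw
          rwa [show d + (b + n) = b + (d + n) by ring]
        exact this ih
      · rw [map_mul, hbr, smul_mul_assoc, one_mul, LinearMap.smul_apply]
        by_cases h0 : d + b = 0
        · refine Submodule.smul_mem _ _ (Submodule.subset_span ⟨u, k, by lia, ?_, rfl⟩)
          rwa [show d + (b + n) = n by lia]
        · rw [hc hd hb h0, zero_smul]; exact zero_mem _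
  have hvac : ∀ (k : ℕ) (n : ℤ) (u), 0 < n → Env.IsMonomial S k n u → φ u v = 0 := by
    intro k
    induction k using Nat.strong_induction_on with
    | _ k IH =>
      intro n u hn hu
      cases hu with
      | one => simp at hn
      | @mul i d x k m u hp hd hu =>
        rw [map_mul, Module.End.mul_apply]
        by_cases hm : 0 < m
        · rw [IH k (by lia) m u hm hu, map_zero]
        · have h1 := hW hp hd (by lia) hu
          have h2 : W k (d + m) ≤ ⊥ := by
            refine Submodule.span_le.2 ?_
            rintro _ ⟨w, l, hl, hw, rfl⟩
            exact IH l (by lia) _ w hn hw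
          exact h2 h1
  let P : Submodule ℂ M :=
    { carrier := {m | ∃ N : ℤ, ∀ n, N ≤ n → ∀ u ∈ Env.degree S n, φ u m = 0}
      zero_mem' := ⟨0, fun _ _ _ _ => map_zero _⟩
      add_mem' := by
        rintro a b ⟨N, hN⟩ ⟨N', hN'⟩
        refine ⟨max N N', fun n hn u hu => ?_⟩
        rw [map_add, hN n (by lia) u hu, hN' n (by lia) u hu, add_zero]
      smul_mem' := by
        rintro r a ⟨N, hN⟩
        exact ⟨N, fun n hn u hu => by rw [map_smul, hN n hn u hu, smul_zero]⟩ }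
  have hP : P = ⊤ := by
    refine hgen P ⟨1, fun n hn u hu => ?_⟩ ?_
    · induction hu using Submodule.span_induction with
      | mem u hu => obtain ⟨k, hk⟩ := hu; exact hvac k n u (by lia) hk
      | zero => simp
      | add a b _ _ ha hb => simp [ha, hb]
      | smul r a _ ha => simp [ha]
    · intro x m hm
      induction x using Env.gr_induction (S := S) with
      | zero => simp
      | add x y hx hy =>
        rw [map_add, map_add, LinearMap.add_apply]
        exact add_mem hx hy
      | hom i d x hx hd =>
        obtain ⟨N, hN⟩ := hm
        refine ⟨N - d, fun n hn u hu => ?_⟩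
        rw [← Module.End.mul_apply, ← map_mul]
        refine hN (n + d) (by lia) _ (Env.degree_mul hu ?_)
        exact Submodule.subset_span ⟨1, by simpa using Env.IsMonomial.mul hx hd Env.IsMonomial.one⟩
  intro m
  have : m ∈ P := hP ▸ Submodule.mem_top
  exact this

end Smooth
/-! ### Quasi-finite graded Lie algebras and the Lie superalgebra `cl(L)` -/

section Grading

variable {W : Type*} [AddCommGroup W] [Module ℂ W] {W' : Type*} [AddCommGroup W'] [Module ℂ W']

theorem isInternal_prod {A : ℤ → Submodule ℂ W} {B : ℤ → Submodule ℂ W'}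
    (hA : DirectSum.IsInternal A) (hB : DirectSum.IsInternal B) :
    DirectSum.IsInternal fun n => (A n).prod (B n) := by
  rw [DirectSum.isInternal_submodule_iff_iSupIndep_and_iSup_eq_top] at *
  refine ⟨?_, ?_⟩
  · rw [iSupIndep_def] at *
    intro n
    have h : (⨆ (j) (_ : j ≠ n), (A j).prod (B j)) ≤
        (⨆ (j) (_ : j ≠ n), A j).prod (⨆ (j) (_ : j ≠ n), B j) :=
      iSup₂_le fun j hj => Submodule.prod_mono (le_iSup₂_of_le j hj le_rfl)
        (le_iSup₂_of_le j hj le_rfl)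
    refine Disjoint.mono_right h ?_
    rw [Submodule.disjoint_def]
    rintro ⟨a, b⟩ ⟨ha, hb⟩ ⟨ha', hb'⟩
    exact Prod.ext (Submodule.disjoint_def.1 (hA.1 n) a ha ha')
      (Submodule.disjoint_def.1 (hB.1 n) b hb hb')
  · rw [eq_top_iff]
    rintro ⟨a, b⟩ -
    have h1 : (⨆ n, A n) ≤ (⨆ n, (A n).prod (B n)).comap (LinearMap.inl ℂ W W') :=
      iSup_le fun n x hx => Submodule.mem_iSup_of_mem n ⟨hx, zero_mem _⟩
    have h2 : (⨆ n, B n) ≤ (⨆ n, (A n).prod (B n)).comap (LinearMap.inr ℂ W W') :=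
      iSup_le fun n x hx => Submodule.mem_iSup_of_mem n ⟨zero_mem _, hx⟩
    have ha : a ∈ ⨆ n, A n := hA.2 ▸ Submodule.mem_top
    have hb : b ∈ ⨆ n, B n := hB.2 ▸ Submodule.mem_top
    have h3 : (a, (0 : W')) ∈ ⨆ n, (A n).prod (B n) := h1 ha
    have h4 : ((0 : W), b) ∈ ⨆ n, (A n).prod (B n) := h2 hb
    simpa using add_mem h3 h4

theorem isInternal_comap {A : ℤ → Submodule ℂ W} (P : Submodule ℂ W) (hA : iSupIndep A)
    (hle : ∀ n, A n ≤ P) (hsup : P ≤ ⨆ n, A n) :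
    DirectSum.IsInternal fun n => (A n).comap P.subtype := by
  rw [DirectSum.isInternal_submodule_iff_iSupIndep_and_iSup_eq_top]
  have hmap : ∀ n, ((A n).comap P.subtype).map P.subtype = A n := fun n => by
    rw [Submodule.map_comap_subtype, inf_eq_right.2 (hle n)]
  refine ⟨?_, ?_⟩
  · rw [iSupIndep_def] at *
    intro n
    rw [Submodule.disjoint_def]
    intro x hx hx'
    have h1 : (x : W) ∈ ⨆ (j) (_ : j ≠ n), A j := by
      have := Submodule.mem_map_of_mem (f := P.subtype) hx'
      simp only [Submodule.map_iSup, hmap] at this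
      exact this
    exact Subtype.ext (Submodule.disjoint_def.1 (hA n) x hx h1)
  · refine Submodule.map_injective_of_injective P.injective_subtype ?_
    rw [Submodule.map_iSup, Submodule.map_subtype_top]
    simp only [hmap]
    exact le_antisymm (iSup_le hle) hsup

/-- The line `ℂ K`, placed in degree `0`. -/
def centralGr (n : ℤ) : Submodule ℂ ℂ := if n = 0 then ⊤ else ⊥

theorem isInternal_centralGr : DirectSum.IsInternal centralGr := by
  rw [DirectSum.isInternal_submodule_iff_iSupIndep_and_iSup_eq_top]
  refine ⟨?_, eq_top_iff.2 (le_iSup_of_le 0 (by simp [centralGr]))⟩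
  rw [iSupIndep_def]
  intro n
  by_cases hn : n = 0
  · have : (⨆ (j) (_ : j ≠ n), centralGr j) = ⊥ := by
      simp only [iSup_eq_bot]
      intro j hj
      simp [centralGr, hn ▸ hj]
    rw [this]
    exact disjoint_bot_right
  · simp [centralGr, hn]

end Grading

variable {L : Type*} [LieRing L] [LieAlgebra ℂ L]

/-- `L = ⨁ 𝓛 n` is a quasi-finite `ℤ`-graded Lie algebra. -/
structure QuasiFinite (𝓛 : ℤ → Submodule ℂ L) : Prop where
  internal : DirectSum.IsInternal 𝓛
  finite : ∀ n, FiniteDimensional ℂ (𝓛 n)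
  lie_mem : ∀ {m n x y}, x ∈ 𝓛 m → y ∈ 𝓛 n → ⁅x, y⁆ ∈ 𝓛 (m + n)

/-- `L^*_n = Hom(L_{-n}, ℂ)`, as the space of the functionals that vanish on `L_m` for `m ≠ -n`. -/
def dualGr (𝓛 : ℤ → Submodule ℂ L) (n : ℤ) : Submodule ℂ (Module.Dual ℂ L) where
  carrier := {f | ∀ m, m ≠ -n → ∀ x ∈ 𝓛 m, f x = 0}
  zero_mem' := fun _ _ _ _ => rfl
  add_mem' := fun hf hg m hm x hx => by
    rw [LinearMap.add_apply, hf m hm x hx, hg m hm x hx, add_zero]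
  smul_mem' := fun c f hf m hm x hx => by rw [LinearMap.smul_apply, hf m hm x hx, smul_zero]

/-- The restricted dual `L^* = ⨁ L^*_n`. -/
def restrictedDual (𝓛 : ℤ → Submodule ℂ L) : Submodule ℂ (Module.Dual ℂ L) := ⨆ n, dualGr 𝓛 n

variable {𝓛 : ℤ → Submodule ℂ L}

theorem QuasiFinite.dual_internal (h : QuasiFinite 𝓛) :
    DirectSum.IsInternal fun n => (dualGr 𝓛 n).comap (restrictedDual 𝓛).subtype := by
  refine isInternal_comap _ ?_ (fun n => le_iSup (dualGr 𝓛) n) le_rfl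
  rw [iSupIndep_def]
  intro n
  rw [Submodule.disjoint_def]
  intro f hf hf'
  have h1 : (⨆ (j) (_ : j ≠ n), dualGr 𝓛 j) ≤ (𝓛 (-n)).dualAnnihilator :=
    iSup₂_le fun j hj g hg => (Submodule.mem_dualAnnihilator g).2
      fun x hx => hg (-n) (by simpa using hj.symm) x hx
  have h2 : (⨆ m, 𝓛 m) ≤ LinearMap.ker f := iSup_le fun m x hx => by
    by_cases hm : m = -n
    · subst hm
      exact (Submodule.mem_dualAnnihilator f).1 (h1 hf') x hx
    · exact hf m hm x hx
  rw [h.internal.submodule_iSup_eq_top] at h2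
  exact LinearMap.ker_eq_top.1 (top_le_iff.1 h2)

/-- The evaluation pairing between the restricted dual and `L`. -/
def pairing (𝓛 : ℤ → Submodule ℂ L) : restrictedDual 𝓛 →ₗ[ℂ] L →ₗ[ℂ] ℂ :=
  (restrictedDual 𝓛).subtype

theorem pairing_eq_zero {m n : ℤ} {u : restrictedDual 𝓛} {x : L}
    (hu : (u : Module.Dual ℂ L) ∈ dualGr 𝓛 n) (hx : x ∈ 𝓛 m) (h : m + n ≠ 0) :
    pairing 𝓛 u x = 0 :=
  hu m (by lia) x hx

/-- The underlying space of `cl(L)`: the triple `((x, u), k)` stands for `ι(x) + ε(u) + k K`. -/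
abbrev ClSpace (𝓛 : ℤ → Submodule ℂ L) : Type _ := (L × restrictedDual 𝓛) × ℂ

/-- The superbracket of `cl(L)`: `[ι(x), ε(u)] = [ε(u), ι(x)] = ⟨u, x⟩ K`, all others vanish. -/
def clBr (𝓛 : ℤ → Submodule ℂ L) : ClSpace 𝓛 →ₗ[ℂ] ClSpace 𝓛 →ₗ[ℂ] ClSpace 𝓛 :=
  LinearMap.mk₂ ℂ (fun a b => (0, pairing 𝓛 a.1.2 b.1.1 + pairing 𝓛 b.1.2 a.1.1))
    (fun a a' b => by ext <;> simp; ring) (fun c a b => by ext <;> simp; ring)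
    (fun a b b' => by ext <;> simp; ring) (fun c a b => by ext <;> simp; ring)

@[simp]
theorem clBr_apply (a b : ClSpace 𝓛) :
    clBr 𝓛 a b = (0, pairing 𝓛 a.1.2 b.1.1 + pairing 𝓛 b.1.2 a.1.1) := rfl

/-- The parity of `cl(L)`: `ι(L) ⊕ ε(L^*)` is odd and `K` is even. -/
def clPar (𝓛 : ℤ → Submodule ℂ L) (i : ZMod 2) : Submodule ℂ (ClSpace 𝓛) :=
  if i = 0 then (⊥ : Submodule ℂ (L × restrictedDual 𝓛)).prod ⊤ else Submodule.prod ⊤ ⊥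

theorem mem_clPar_zero {a : ClSpace 𝓛} : a ∈ clPar 𝓛 0 ↔ a.1 = 0 := by
  simp [clPar, Submodule.mem_prod]

theorem mem_clPar_one {a : ClSpace 𝓛} : a ∈ clPar 𝓛 1 ↔ a.2 = 0 := by
  simp [clPar, Submodule.mem_prod]

/-- The grading of `cl(L)`. -/
def clGr (𝓛 : ℤ → Submodule ℂ L) (n : ℤ) : Submodule ℂ (ClSpace 𝓛) :=
  ((𝓛 n).prod ((dualGr 𝓛 n).comap (restrictedDual 𝓛).subtype)).prod (centralGr n)

theorem clBr_gr {m n : ℤ} {a b : ClSpace 𝓛} (ha : a ∈ clGr 𝓛 m) (hb : b ∈ clGr 𝓛 n)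
    (h : m + n ≠ 0) : clBr 𝓛 a b = 0 := by
  rw [clBr_apply, pairing_eq_zero ha.1.2 hb.1.1 (by lia), pairing_eq_zero hb.1.2 ha.1.1 h]
  simp

theorem zmod_two_cases {p : ZMod 2 → Prop} (h0 : p 0) (h1 : p 1) (i : ZMod 2) : p i := by
  fin_cases i
  exacts [h0, h1]

/-- The Lie superalgebra `cl(L) = ι(L) ⊕ ε(L^*) ⊕ ℂ K`. -/
def clLie (h : QuasiFinite 𝓛) : GradedLieSuperalgebra (ClSpace 𝓛) where
  par := clPar 𝓛
  gr := clGr 𝓛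
  br := clBr 𝓛
  isCompl_par := by
    refine ⟨Submodule.disjoint_def.2 fun a h0 h1 =>
      Prod.ext (mem_clPar_zero.1 h0) (mem_clPar_one.1 h1), codisjoint_iff_le_sup.2 fun a _ => ?_⟩
    exact Submodule.mem_sup.2 ⟨(0, a.2), mem_clPar_zero.2 rfl, (a.1, 0), mem_clPar_one.2 rfl,
      by simp⟩
  internal_gr := isInternal_prod (isInternal_prod h.internal h.dual_internal) isInternal_centralGr
  gr_le n a ha := Submodule.mem_sup.2 ⟨(0, a.2), ⟨⟨zero_mem _, ha.2⟩, mem_clPar_zero.2 rfl⟩,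
    (a.1, 0), ⟨⟨ha.1, zero_mem _⟩, mem_clPar_one.2 rfl⟩, by simp⟩
  br_par {i j x y} hx hy := by
    induction i using zmod_two_cases <;> induction j using zmod_two_cases <;>
      simp_all [mem_clPar_zero, mem_clPar_one, show (1 + 1 : ZMod 2) = 0 from rfl]
  br_gr {m n x y} hx hy := by
    by_cases hmn : m + n = 0
    · rw [hmn]
      exact ⟨zero_mem _, by simp [centralGr]⟩
    · rw [clBr_gr hx hy hmn]
      exact zero_mem _
  skew {i j x y} hx hy := by
    induction i using zmod_two_cases <;> induction j using zmod_two_cases <;>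
      simp_all [mem_clPar_zero, mem_clPar_one, koszul, ZMod.val_one, add_comm]
  jacobi z _ _ := by simp

/-- The central element `K` of `cl(L)`. -/
def clK (𝓛 : ℤ → Submodule ℂ L) : ClSpace 𝓛 := (0, 1)

/-! ### The Lie superalgebra `c(L)` -/

/-- An alternating bilinear form `γ` on `L` with `γ(L_m, L_n) = 0` for `m + n ≠ 0`. -/
structure GradedAltForm (𝓛 : ℤ → Submodule ℂ L) where
  form : L →ₗ[ℂ] L →ₗ[ℂ] ℂ
  alt : ∀ x, form x x = 0
  gr : ∀ {m n x y}, x ∈ 𝓛 m → y ∈ 𝓛 n → m + n ≠ 0 → form x y = 0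

instance : Zero (GradedAltForm 𝓛) := ⟨⟨0, fun _ => rfl, fun _ _ _ => rfl⟩⟩

theorem GradedAltForm.neg (γ : GradedAltForm 𝓛) (x y : L) : γ.form x y = -γ.form y x := by
  have := γ.alt (x + y)
  simp only [map_add, LinearMap.add_apply, γ.alt] at this
  linear_combination this

/-- A graded complement `F` of the radical `ker γ = {x | γ(x, L) = 0}` in `L`. -/
structure GradedComplement (γ : GradedAltForm 𝓛) where
  F : Submodule ℂ L
  isCompl : IsCompl F (LinearMap.ker γ.form)
  graded : F ≤ ⨆ n, F ⊓ 𝓛 n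

variable {γ : GradedAltForm 𝓛}

/-- The component `F_n = F ∩ L_n`. -/
def GradedComplement.gr (C : GradedComplement γ) (n : ℤ) : Submodule ℂ C.F :=
  (C.F ⊓ 𝓛 n).comap C.F.subtype

theorem GradedComplement.internal (h : QuasiFinite 𝓛) (C : GradedComplement γ) :
    DirectSum.IsInternal C.gr :=
  isInternal_comap C.F (h.internal.submodule_iSupIndep.mono fun _ => inf_le_right)
    (fun _ => inf_le_left) C.graded

theorem GradedComplement.form_eq_zero (C : GradedComplement γ) {m n : ℤ} {f g : C.F}
    (hf : f ∈ C.gr m) (hg : g ∈ C.gr n) (h : m + n ≠ 0) : γ.form f g = 0 :=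
  γ.gr hf.2 hg.2 h

/-- The underlying space of `c(L) = cl(L) ⊕ ϵ(F)`. -/
abbrev CSpace (C : GradedComplement γ) : Type _ := ClSpace 𝓛 × C.F

/-- The superbracket of `c(L)`: `ϵ(F)` commutes with `cl(L)`, and
`[ϵ(f), ϵ(g)] = -γ(f, g) K`. -/
def cBr (C : GradedComplement γ) : CSpace C →ₗ[ℂ] CSpace C →ₗ[ℂ] CSpace C :=
  LinearMap.mk₂ ℂ (fun a b => (clBr 𝓛 a.1 b.1 - γ.form a.2 b.2 • clK 𝓛, 0))
    (fun a a' b => by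
      simp only [Prod.fst_add, Prod.snd_add, map_add, LinearMap.add_apply, Submodule.coe_add,
        add_smul, Prod.mk_add_mk, add_zero]
      abel_nf)
    (fun c a b => by simp only [Prod.smul_fst, Prod.smul_snd, map_smul, LinearMap.smul_apply,
      Submodule.coe_smul, smul_sub, Prod.smul_mk, smul_zero, smul_eq_mul, mul_smul])
    (fun a b b' => by
      simp only [Prod.fst_add, Prod.snd_add, map_add, Submodule.coe_add,
        add_smul, Prod.mk_add_mk, add_zero]
      abel_nf)
    (fun c a b => by simp only [Prod.smul_fst, Prod.smul_snd, map_smul,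
      Submodule.coe_smul, smul_sub, Prod.smul_mk, smul_zero, smul_eq_mul, mul_smul])

@[simp]
theorem cBr_apply (C : GradedComplement γ) (a b : CSpace C) :
    cBr C a b = (clBr 𝓛 a.1 b.1 - γ.form a.2 b.2 • clK 𝓛, 0) := rfl

/-- The parity of `c(L)`: `ϵ(F)` is even. -/
def cPar (C : GradedComplement γ) (i : ZMod 2) : Submodule ℂ (CSpace C) :=
  (clPar 𝓛 i).prod (if i = 0 then ⊤ else ⊥)

/-- The grading of `c(L)`. -/
def cGr (C : GradedComplement γ) (n : ℤ) : Submodule ℂ (CSpace C) := (clGr 𝓛 n).prod (C.gr n)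

theorem mem_cPar_zero {C : GradedComplement γ} {a : CSpace C} : a ∈ cPar C 0 ↔ a.1.1 = 0 := by
  simp [cPar, Submodule.mem_prod, mem_clPar_zero]

theorem mem_cPar_one {C : GradedComplement γ} {a : CSpace C} :
    a ∈ cPar C 1 ↔ a.1.2 = 0 ∧ a.2 = 0 := by
  simp [cPar, Submodule.mem_prod, mem_clPar_one]

theorem cBr_gr {C : GradedComplement γ} {m n : ℤ} {a b : CSpace C} (ha : a ∈ cGr C m)
    (hb : b ∈ cGr C n) (h : m + n ≠ 0) : cBr C a b = 0 := by
  rw [cBr_apply, clBr_gr ha.1 hb.1 h, C.form_eq_zero ha.2 hb.2 h]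
  simp

/-- The Lie superalgebra `c(L) = ι(L) ⊕ ε(L^*) ⊕ ℂ K ⊕ ϵ(F)`. -/
def cLie (h : QuasiFinite 𝓛) (C : GradedComplement γ) : GradedLieSuperalgebra (CSpace C) where
  par := cPar C
  gr := cGr C
  br := cBr C
  isCompl_par := by
    refine ⟨Submodule.disjoint_def.2 fun a h0 h1 => ?_, codisjoint_iff_le_sup.2 fun a _ => ?_⟩
    · exact Prod.ext (Prod.ext (mem_cPar_zero.1 h0) (mem_cPar_one.1 h1).1) (mem_cPar_one.1 h1).2
    · exact Submodule.mem_sup.2 ⟨((0, a.1.2), a.2), mem_cPar_zero.2 rfl, ((a.1.1, 0), 0),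
        mem_cPar_one.2 ⟨rfl, rfl⟩, by simp⟩
  internal_gr := isInternal_prod (clLie h).internal_gr (C.internal h)
  gr_le n a ha := Submodule.mem_sup.2 ⟨((0, a.1.2), a.2),
    ⟨⟨⟨zero_mem _, ha.1.2⟩, ha.2⟩, mem_cPar_zero.2 rfl⟩, ((a.1.1, 0), 0),
    ⟨⟨⟨ha.1.1, zero_mem _⟩, zero_mem _⟩, mem_cPar_one.2 ⟨rfl, rfl⟩⟩, by simp⟩
  br_par {i j x y} hx hy := by
    induction i using zmod_two_cases <;> induction j using zmod_two_cases <;>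
      simp_all [mem_cPar_zero, mem_cPar_one, clK, show (1 + 1 : ZMod 2) = 0 from rfl]
  br_gr {m n x y} hx hy := by
    by_cases hmn : m + n = 0
    · rw [hmn]
      exact ⟨⟨by simp [clK], by simp [centralGr]⟩, zero_mem _⟩
    · rw [cBr_gr hx hy hmn]
      exact zero_mem _
  skew {i j x y} hx hy := by
    induction i using zmod_two_cases <;> induction j using zmod_two_cases <;>
      simp_all [mem_cPar_zero, mem_cPar_one, koszul, ZMod.val_one, add_comm, clK]
    exact (γ.neg _ _).symm
  jacobi z _ _ := by simp [clK]

/-- The central element `K` of `c(L)`. -/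
def cK (C : GradedComplement γ) : CSpace C := (clK 𝓛, 0)

/-! ### Semi-infinite forms -/

/-- A homogeneous basis `e_i` of `L`, with `e_i ∈ L_{deg i}`, indexed by a linear order along which
the degree does not decrease. If the index set is `ℤ` and the basis is numbered so that
`{e_i | i ≤ 0}` is a basis of `L_{≤ 0}`, then `deg i ≤ 0` means `i ≤ 0`. -/
structure OrderedBasis (𝓛 : ℤ → Submodule ℂ L) (ι : Type*) [LinearOrder ι] where
  basis : Module.Basis ι ℂ L
  deg : ι → ℤ
  mem : ∀ i, basis i ∈ 𝓛 (deg i)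
  mono : Monotone deg

section Forms

variable {ι : Type*} [LinearOrder ι] (e : OrderedBasis 𝓛 ι)

theorem OrderedBasis.repr_eq_zero (h : QuasiFinite 𝓛) {n : ℤ} {x : L} (hx : x ∈ 𝓛 n) {i : ι}
    (hi : e.deg i ≠ n) : e.basis.repr x i = 0 := by
  let P (m : ℤ) : Submodule ℂ L := Submodule.span ℂ (e.basis '' {j | e.deg j = m})
  have hP : ∀ m, P m ≤ 𝓛 m := fun m => Submodule.span_le.2 (by
    rintro _ ⟨j, rfl, rfl⟩
    exact e.mem j)
  have hx' : x ∈ P n := by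
    have h1 : x ∈ P n ⊔ ⨆ (m) (_ : m ≠ n), P m := by
      have : (⊤ : Submodule ℂ L) ≤ P n ⊔ ⨆ (m) (_ : m ≠ n), P m := by
        rw [← e.basis.span_eq, Submodule.span_le]
        rintro _ ⟨j, rfl⟩
        by_cases hj : e.deg j = n
        · exact Submodule.mem_sup_left (Submodule.subset_span ⟨j, hj, rfl⟩)
        · exact Submodule.mem_sup_right (Submodule.mem_iSup_of_mem (e.deg j)
            (Submodule.mem_iSup_of_mem hj (Submodule.subset_span ⟨j, rfl, rfl⟩)))
      exact this trivial
    obtain ⟨y, hy, z, hz, rfl⟩ := Submodule.mem_sup.1 h1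
    have hz' : z ∈ ⨆ (m) (_ : m ≠ n), 𝓛 m := iSup₂_mono (fun m _ => hP m) hz
    have hzn : z ∈ 𝓛 n := by simpa using sub_mem hx (hP n hy)
    have : z = 0 := Submodule.disjoint_def.1 (iSupIndep_def.1 h.internal.submodule_iSupIndep n)
      z hzn hz'
    rw [this, add_zero]
    exact hy
  have := e.basis.repr_support_subset_of_mem_span {j | e.deg j = n} hx'
  by_contra hne
  exact hi (this (by simpa using hne))

theorem OrderedBasis.finite_fiber (h : QuasiFinite 𝓛) (n : ℤ) : {i | e.deg i = n}.Finite := by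
  have := h.finite n
  have hl : LinearIndependent ℂ fun i : {i | e.deg i = n} =>
      (⟨e.basis i, by have := e.mem i; rwa [i.2] at this⟩ : 𝓛 n) :=
    LinearIndependent.of_comp (𝓛 n).subtype
      (e.basis.linearIndependent.comp _ Subtype.val_injective)
  exact Set.finite_coe_iff.1 hl.finite

/-- The dual basis vector `e_i^*`, an element of the restricted dual. -/
def OrderedBasis.dual (h : QuasiFinite 𝓛) (i : ι) : restrictedDual 𝓛 :=
  ⟨e.basis.coord i, Submodule.mem_iSup_of_mem (-e.deg i) fun _ hm _ hx =>
    e.repr_eq_zero h hx (by simpa using hm.symm)⟩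

/-- The coordinates of an element of the restricted dual with respect to the dual basis. -/
def OrderedBasis.dualCoord (h : QuasiFinite 𝓛) : restrictedDual 𝓛 →ₗ[ℂ] ι →₀ ℂ where
  toFun u := Finsupp.ofSupportFinite (fun i => pairing 𝓛 u (e.basis i)) (by
    obtain ⟨u, hu⟩ := u
    change {i | u (e.basis i) ≠ 0}.Finite
    refine Submodule.iSup_induction (dualGr 𝓛) (motive := fun u => {i | u (e.basis i) ≠ 0}.Finite)
      hu (fun n f hf => ?_) (by simp) (fun f g hf hg => ?_)
    · refine (e.finite_fiber h (-n)).subset fun i hi => ?_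
      by_contra hne
      exact hi (hf _ hne _ (e.mem i))
    · refine (hf.union hg).subset fun i hi => ?_
      by_contra hne
      simp only [Set.mem_union, Set.mem_ofPred_eq, not_or, not_not] at hne
      exact hi (by rw [LinearMap.add_apply, hne.1, hne.2, add_zero]))
  map_add' u v := by ext i; simp [Finsupp.ofSupportFinite_coe]
  map_smul' a u := by ext i; simp [Finsupp.ofSupportFinite_coe]

theorem OrderedBasis.dualCoord_apply (h : QuasiFinite 𝓛) (u : restrictedDual 𝓛) (i : ι) :
    e.dualCoord h u i = pairing 𝓛 u (e.basis i) := rfl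

/-- The indices of the basis vectors of `L_{≤ 0}`. -/
def OrderedBasis.sea : Set ι := {i | e.deg i ≤ 0}

/-- The index sets `{i_1 > i_2 > ⋯}` of the semi-infinite monomials
`e_{i_1}^* ∧ e_{i_2}^* ∧ ⋯`: the sets that differ from `{i | deg i ≤ 0}` by finitely many elements.
If the index set is `ℤ`, they are the ranges of the decreasing sequences with `i_{k+1} = i_k - 1`
for all large `k`. -/
def SemiInfiniteSet : Type _ := {S : Set ι // (S \ e.sea).Finite ∧ (e.sea \ S).Finite}

namespace SemiInfiniteSet

variable {e}

theorem finite_above (h : QuasiFinite 𝓛) (S : SemiInfiniteSet e) (j : ι) :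
    {s ∈ S.1 | j < s}.Finite := by
  have h1 : (e.deg ⁻¹' Set.Icc (e.deg j) 0).Finite :=
    (Set.finite_Icc _ _).preimage' fun n _ => e.finite_fiber h n
  refine (S.2.1.union h1).subset fun s hs => ?_
  by_cases h0 : e.deg s ≤ 0
  · exact Or.inr ⟨e.mono hs.2.le, h0⟩
  · exact Or.inl ⟨hs.1, h0⟩

/-- Add an index. -/
def ins (j : ι) (S : SemiInfiniteSet e) : SemiInfiniteSet e :=
  ⟨insert j S.1, (S.2.1.insert j).subset (by
    rintro s ⟨rfl | hs, h0⟩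
    · exact Or.inl rfl
    · exact Or.inr ⟨hs, h0⟩), S.2.2.subset fun s hs => ⟨hs.1, fun h => hs.2 (Or.inr h)⟩⟩

/-- Remove an index. -/
def del (j : ι) (S : SemiInfiniteSet e) : SemiInfiniteSet e :=
  ⟨S.1 \ {j}, S.2.1.subset fun s hs => ⟨hs.1.1, hs.2⟩, (S.2.2.insert j).subset fun s hs => by
    by_cases hj : s = j
    · exact Or.inl hj
    · exact Or.inr ⟨hs.1, fun h => hs.2 ⟨h, hj⟩⟩⟩

/-- The sign `(-1)^(number of indices in S that precede j)`, where the indices of a monomial are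
listed in decreasing order. -/
def sign (j : ι) (S : SemiInfiniteSet e) : ℂ := (-1) ^ {s ∈ S.1 | j < s}.ncard

theorem sign_mul_sign (j : ι) (S : SemiInfiniteSet e) : sign j S * sign j S = 1 := by
  rw [sign, ← mul_pow]; simp

theorem sign_ins_of_lt (h : QuasiFinite 𝓛) {j k : ι} {S : SemiInfiniteSet e} (hk : k ∉ S.1)
    (hjk : j < k) : sign j (ins k S) = -sign j S := by
  have : {s ∈ (ins k S).1 | j < s} = insert k {s ∈ S.1 | j < s} := by
    ext s
    simp only [ins, Set.mem_insert_iff, Set.mem_ofPred_eq]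
    constructor
    · rintro ⟨rfl | hs, h1⟩
      exacts [Or.inl rfl, Or.inr ⟨hs, h1⟩]
    · rintro (rfl | hs)
      exacts [⟨Or.inl rfl, hjk⟩, ⟨Or.inr hs.1, hs.2⟩]
  rw [sign, this, Set.ncard_insert_of_notMem (fun h => hk h.1) (S.finite_above h j), pow_succ, sign]
  ring

theorem sign_ins_of_le {j k : ι} {S : SemiInfiniteSet e} (hjk : k ≤ j) :
    sign j (ins k S) = sign j S := by
  have : {s ∈ (ins k S).1 | j < s} = {s ∈ S.1 | j < s} := by
    ext s
    simp only [ins, Set.mem_insert_iff, Set.mem_ofPred_eq]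
    constructor
    · rintro ⟨rfl | hs, h1⟩
      exacts [absurd h1 hjk.not_gt, ⟨hs, h1⟩]
    · exact fun hs => ⟨Or.inr hs.1, hs.2⟩
  rw [sign, this, sign]

theorem ins_del {k : ι} {S : SemiInfiniteSet e} (hk : k ∈ S.1) : ins k (del k S) = S :=
  Subtype.ext (by simp [ins, del, hk])

theorem del_ins {k : ι} {S : SemiInfiniteSet e} (hk : k ∉ S.1) : del k (ins k S) = S :=
  Subtype.ext (by simp [ins, del, hk])

theorem ins_comm (j k : ι) (S : SemiInfiniteSet e) : ins j (ins k S) = ins k (ins j S) :=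
  Subtype.ext (Set.insert_comm j k S.1)

theorem del_comm (j k : ι) (S : SemiInfiniteSet e) : del j (del k S) = del k (del j S) :=
  Subtype.ext (Set.sdiff_sdiff_comm)

theorem del_ins_comm {j k : ι} (hjk : j ≠ k) (S : SemiInfiniteSet e) :
    del j (ins k S) = ins k (del j S) :=
  Subtype.ext (Set.insert_sdiff_of_notMem _ (by simpa using hjk.symm))

theorem sign_del_of_lt (h : QuasiFinite 𝓛) {j k : ι} {S : SemiInfiniteSet e} (hk : k ∈ S.1)
    (hjk : j < k) : sign j (del k S) = -sign j S := by
  have := sign_ins_of_lt h (S := del k S) (k := k) (by simp [del]) hjk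
  rw [ins_del hk] at this
  rw [this, neg_neg]

theorem sign_del_of_le {j k : ι} {S : SemiInfiniteSet e} (hjk : k ≤ j) :
    sign j (del k S) = sign j S := by
  by_cases hk : k ∈ S.1
  · have := sign_ins_of_le (S := del k S) hjk
    rw [ins_del hk] at this
    exact this.symm
  · congr 1
    exact Subtype.ext (by simp [del, hk])

theorem mem_ins {j k : ι} {S : SemiInfiniteSet e} : j ∈ (ins k S).1 ↔ j = k ∨ j ∈ S.1 := Iff.rfl

theorem mem_del {j k : ι} {S : SemiInfiniteSet e} : j ∈ (del k S).1 ↔ j ∈ S.1 ∧ j ≠ k := Iff.rfl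

/-- The index set of the vacuum `ω_0`. -/
def vacuum : SemiInfiniteSet e := ⟨e.sea, by simp, by simp⟩

end SemiInfiniteSet

/-- The space `Λ^{∞/2 + •} L^*` of semi-infinite forms: the complex vector space with the
semi-infinite monomials as a basis. -/
def Forms : Type _ := SemiInfiniteSet e →₀ ℂ

instance : AddCommGroup (Forms e) := inferInstanceAs (AddCommGroup (SemiInfiniteSet e →₀ ℂ))

instance : Module ℂ (Forms e) := inferInstanceAs (Module ℂ (SemiInfiniteSet e →₀ ℂ))

/-- The basis of semi-infinite monomials. -/
def monomial : Module.Basis (SemiInfiniteSet e) ℂ (Forms e) := .ofRepr (LinearEquiv.refl ℂ _)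

open SemiInfiniteSet

variable {e}

open Classical in
/-- The operator `ε(e_j^*)`: `ω ↦ e_j^* ∧ ω`. -/
def wedgeBasis (j : ι) : Module.End ℂ (Forms e) :=
  (monomial e).constr ℂ fun S => if j ∈ S.1 then 0 else sign j S • monomial e (ins j S)

open Classical in
/-- The operator `ι(e_j)`: the contraction
`e_{i_1}^* ∧ e_{i_2}^* ∧ ⋯ ↦ ∑ (-1)^(k-1) ⟨e_{i_k}^*, e_j⟩ e_{i_1}^* ∧ ⋯ ∧ ê_{i_k}^* ∧ ⋯`. -/
def contractBasis (j : ι) : Module.End ℂ (Forms e) :=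
  (monomial e).constr ℂ fun S => if j ∈ S.1 then sign j S • monomial e (del j S) else 0

theorem wedgeBasis_mem {j : ι} {S : SemiInfiniteSet e} (h : j ∈ S.1) :
    wedgeBasis j (monomial e S) = 0 := by simp [wedgeBasis, h]

theorem wedgeBasis_notMem {j : ι} {S : SemiInfiniteSet e} (h : j ∉ S.1) :
    wedgeBasis j (monomial e S) = sign j S • monomial e (ins j S) := by
  simp [wedgeBasis, h]

theorem contractBasis_mem {j : ι} {S : SemiInfiniteSet e} (h : j ∈ S.1) :
    contractBasis j (monomial e S) = sign j S • monomial e (del j S) := by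
  simp [contractBasis, h]

theorem contractBasis_notMem {j : ι} {S : SemiInfiniteSet e} (h : j ∉ S.1) :
    contractBasis j (monomial e S) = 0 := by simp [contractBasis, h]

theorem forms_ext {A B : Module.End ℂ (Forms e)}
    (h : ∀ S : SemiInfiniteSet e, A (monomial e S) = B (monomial e S)) : A = B :=
  (monomial e).ext h

theorem wedge_wedge (h : QuasiFinite 𝓛) (j k : ι) :
    (wedgeBasis j * wedgeBasis k : Module.End ℂ (Forms e)) = -(wedgeBasis k * wedgeBasis j) := by
  wlog hjk : j ≤ k generalizing j k
  · rw [this k j (le_of_not_ge hjk), neg_neg]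
  refine forms_ext fun S => ?_
  rw [LinearMap.neg_apply, Module.End.mul_apply, Module.End.mul_apply]
  by_cases hj : j ∈ S.1 <;> by_cases hk : k ∈ S.1
  · simp [wedgeBasis_mem hj, wedgeBasis_mem hk]
  · rw [wedgeBasis_notMem hk, wedgeBasis_mem hj, map_smul, wedgeBasis_mem (mem_ins.2 (Or.inr hj))]
    simp
  · rw [wedgeBasis_notMem hj, wedgeBasis_mem hk, map_smul, wedgeBasis_mem (mem_ins.2 (Or.inr hk))]
    simp
  · rcases hjk.eq_or_lt with rfl | hlt
    · rw [wedgeBasis_notMem hj, map_smul, wedgeBasis_mem (mem_ins.2 (Or.inl rfl))]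
      simp
    · rw [wedgeBasis_notMem hj, wedgeBasis_notMem hk, map_smul, map_smul,
        wedgeBasis_notMem (by simp [mem_ins, hj, hlt.ne]),
        wedgeBasis_notMem (by simp [mem_ins, hk, hlt.ne']), sign_ins_of_lt h hk hlt,
        sign_ins_of_le hlt.le, ins_comm, smul_smul, smul_smul, ← neg_smul]
      congr 1
      ring

theorem contract_contract (h : QuasiFinite 𝓛) (j k : ι) :
    (contractBasis j * contractBasis k : Module.End ℂ (Forms e)) =
      -(contractBasis k * contractBasis j) := by
  wlog hjk : j ≤ k generalizing j k
  · rw [this k j (le_of_not_ge hjk), neg_neg]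
  refine forms_ext fun S => ?_
  rw [LinearMap.neg_apply, Module.End.mul_apply, Module.End.mul_apply]
  by_cases hj : j ∈ S.1 <;> by_cases hk : k ∈ S.1
  · rcases hjk.eq_or_lt with rfl | hlt
    · rw [contractBasis_mem hj, map_smul, contractBasis_notMem (by simp [mem_del])]
      simp
    · rw [contractBasis_mem hj, contractBasis_mem hk, map_smul, map_smul,
        contractBasis_mem (by simp [mem_del, hj, hlt.ne]),
        contractBasis_mem (by simp [mem_del, hk, hlt.ne']), sign_del_of_lt h hk hlt,
        sign_del_of_le hlt.le, del_comm, smul_smul, smul_smul, ← neg_smul]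
      congr 1
      ring
  · rw [contractBasis_mem hj, contractBasis_notMem hk, map_smul,
      contractBasis_notMem (by simp [mem_del, hk])]
    simp
  · rw [contractBasis_mem hk, contractBasis_notMem hj, map_smul,
      contractBasis_notMem (by simp [mem_del, hj])]
    simp
  · simp [contractBasis_notMem hj, contractBasis_notMem hk]

theorem contract_wedge (h : QuasiFinite 𝓛) (j k : ι) :
    (contractBasis j * wedgeBasis k + wedgeBasis k * contractBasis j : Module.End ℂ (Forms e)) =
      if j = k then 1 else 0 := by
  refine forms_ext fun S => ?_
  rw [LinearMap.add_apply, Module.End.mul_apply, Module.End.mul_apply]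
  split_ifs with hjk
  · subst hjk
    by_cases hj : j ∈ S.1
    · rw [wedgeBasis_mem hj, contractBasis_mem hj, map_smul,
        wedgeBasis_notMem (by simp [mem_del]), sign_del_of_le le_rfl, smul_smul, sign_mul_sign,
        ins_del hj]
      simp
    · rw [wedgeBasis_notMem hj, contractBasis_notMem hj, map_smul,
        contractBasis_mem (by simp [mem_ins]), sign_ins_of_le le_rfl, smul_smul, sign_mul_sign,
        del_ins hj]
      simp
  · by_cases hj : j ∈ S.1 <;> by_cases hk : k ∈ S.1
    · rw [wedgeBasis_mem hk, contractBasis_mem hj, map_smul,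
        wedgeBasis_mem (by simp [mem_del, hk, Ne.symm hjk])]
      simp
    · rw [wedgeBasis_notMem hk, contractBasis_mem hj, map_smul, map_smul,
        wedgeBasis_notMem (by simp [mem_del, hk]), contractBasis_mem (by simp [mem_ins, hj]),
        del_ins_comm hjk, smul_smul, smul_smul, ← add_smul, LinearMap.zero_apply]
      convert! zero_smul ℂ _
      rcases lt_or_gt_of_ne hjk with hlt | hlt
      · rw [sign_ins_of_lt h hk hlt, sign_del_of_le hlt.le]
        ring
      · rw [sign_ins_of_le hlt.le, sign_del_of_lt h hj hlt]
        ring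
    · rw [wedgeBasis_mem hk, contractBasis_notMem hj]
      simp
    · rw [wedgeBasis_notMem hk, contractBasis_notMem hj, map_smul,
        contractBasis_notMem (by simp [mem_ins, hj, hjk])]
      simp

/-- The operator `ε(u)` on semi-infinite forms, `u ∈ L^*`. -/
def wedge (h : QuasiFinite 𝓛) (e : OrderedBasis 𝓛 ι) :
    restrictedDual 𝓛 →ₗ[ℂ] Module.End ℂ (Forms e) :=
  Finsupp.linearCombination ℂ wedgeBasis ∘ₗ e.dualCoord h

/-- The operator `ι(x)` on semi-infinite forms, `x ∈ L`. -/
def contract (e : OrderedBasis 𝓛 ι) : L →ₗ[ℂ] Module.End ℂ (Forms e) :=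
  Finsupp.linearCombination ℂ contractBasis ∘ₗ e.basis.repr.toLinearMap

/-- Bilinear extension of an anticommutation relation from basis vectors. -/
theorem anticomm_extend {ι A : Type*} [Ring A] [Algebra ℂ A] (f g : ι → A) (p : ι → ι → ℂ)
    (h : ∀ i j, f i * g j + g j * f i = p i j • 1) (a b : ι →₀ ℂ) :
    Finsupp.linearCombination ℂ f a * Finsupp.linearCombination ℂ g b +
      Finsupp.linearCombination ℂ g b * Finsupp.linearCombination ℂ f a =
      (a.sum fun i r => b.sum fun j s => r * s * p i j) • (1 : A) := by
  simp only [Finsupp.linearCombination_apply, Finsupp.sum, Finset.sum_mul, Finset.mul_sum,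
    Finset.sum_smul]
  rw [Finset.sum_comm (s := b.support), ← Finset.sum_add_distrib]
  refine Finset.sum_congr rfl fun i _ => ?_
  rw [← Finset.sum_add_distrib]
  refine Finset.sum_congr rfl fun j _ => ?_
  rw [smul_mul_smul_comm, smul_mul_smul_comm, mul_comm (b j), ← smul_add, h, smul_smul]

theorem wedge_anticomm (h : QuasiFinite 𝓛) (u v : restrictedDual 𝓛) :
    wedge h e u * wedge h e v + wedge h e v * wedge h e u = 0 := by
  have := anticomm_extend (A := Module.End ℂ (Forms e)) wedgeBasis wedgeBasis (fun _ _ => 0)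
    (fun i j => by rw [wedge_wedge h, neg_add_cancel, zero_smul]) (e.dualCoord h u) (e.dualCoord h v)
  refine this.trans ?_
  simp [Finsupp.sum]

theorem contract_anticomm (h : QuasiFinite 𝓛) (x y : L) :
    contract e x * contract e y + contract e y * contract e x = 0 := by
  have := anticomm_extend (A := Module.End ℂ (Forms e)) contractBasis contractBasis
    (fun _ _ => 0) (fun i j => by rw [contract_contract h, neg_add_cancel, zero_smul]) (e.basis.repr x) (e.basis.repr y)
  refine this.trans ?_
  simp [Finsupp.sum]

theorem contract_wedge_anticomm (h : QuasiFinite 𝓛) (x : L) (u : restrictedDual 𝓛) :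
    contract e x * wedge h e u + wedge h e u * contract e x = pairing 𝓛 u x • 1 := by
  have := anticomm_extend (A := Module.End ℂ (Forms e)) contractBasis wedgeBasis
    (fun i j => if i = j then 1 else 0)
    (fun i j => by rw [contract_wedge h]; split_ifs <;> simp) (e.basis.repr x) (e.dualCoord h u)
  refine this.trans ?_
  congr 1
  conv_rhs => rw [← e.basis.linearCombination_repr x, Finsupp.linearCombination_apply, map_finsuppSum]
  refine Finsupp.sum_congr fun i _ => ?_
  rw [map_smul, smul_eq_mul, ← e.dualCoord_apply h]
  by_cases hi : e.dualCoord h u i = 0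
  · rw [hi, mul_zero]
    refine Finset.sum_eq_zero fun j _ => ?_
    by_cases hij : i = j
    · subst hij; simp [hi]
    · simp [hij]
  · rw [Finsupp.sum, Finset.sum_eq_single i]
    · simp
    · intro j _ hj; simp [hj.symm]
    · intro hn; simp at hn; exact absurd hn hi

/-- The linear map that sends an element of `cl(L)` to its operator on semi-infinite forms; `K` acts
as the identity. -/
def clOp (h : QuasiFinite 𝓛) (e : OrderedBasis 𝓛 ι) : ClSpace 𝓛 →ₗ[ℂ] Module.End ℂ (Forms e) :=
  ((contract e).coprod (wedge h e)).coprod (LinearMap.toSpanSingleton ℂ _ 1)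

theorem clOp_apply (h : QuasiFinite 𝓛) (a : ClSpace 𝓛) :
    clOp h e a = contract e a.1.1 + wedge h e a.1.2 + a.2 • 1 := rfl

theorem clOp_mul (h : QuasiFinite 𝓛) {i j : ZMod 2} {x y : ClSpace 𝓛} (hx : x ∈ clPar 𝓛 i)
    (hy : y ∈ clPar 𝓛 j) :
    clOp h e x * clOp h e y = koszul i j • (clOp h e y * clOp h e x) +
      clOp h e (clBr 𝓛 x y) := by
  obtain ⟨⟨x, u⟩, k⟩ := x
  obtain ⟨⟨y, v⟩, l⟩ := y
  simp only [clOp_apply, clBr_apply]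
  induction i using zmod_two_cases <;> induction j using zmod_two_cases <;>
    simp_all [mem_clPar_zero, mem_clPar_one, koszul, ZMod.val_one]
  rw [smul_comm]
  have h1 := wedge_anticomm (e := e) h u v
  have h2 := contract_anticomm (e := e) h x y
  have h3 := contract_wedge_anticomm (e := e) h x v
  have h4 := contract_wedge_anticomm (e := e) h y u
  rw [add_smul, ← h3, ← h4]
  rw [← eq_neg_iff_add_eq_zero] at h1 h2
  simp only [add_mul, mul_add, h1, h2]
  abel

/-- The action of `U(cl(L))` on semi-infinite forms. -/
def clRep (h : QuasiFinite 𝓛) (e : OrderedBasis 𝓛 ι) :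
    Env (clLie h) →ₐ[ℂ] Module.End ℂ (Forms e) :=
  Env.lift (clOp h e) (clOp_mul h)

theorem clRep_of (h : QuasiFinite 𝓛) (x : ClSpace 𝓛) :
    clRep h e (Env.of (clLie h) x) = clOp h e x := Env.lift_of _ _ _

/-- The vacuum vector `ω_0 = e_0^* ∧ e_{-1}^* ∧ ⋯`. -/
def vacuumForm : Forms e := monomial e vacuum

theorem clOp_vacuum (h : QuasiFinite 𝓛) {n : ℤ} (hn : 0 < n) {x : ClSpace 𝓛}
    (hx : x ∈ clGr 𝓛 n) : clOp h e x vacuumForm = 0 := by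
  obtain ⟨⟨x, u⟩, k⟩ := x
  obtain ⟨⟨hx, hu⟩, hk⟩ := hx
  have hk0 : k = 0 := by simpa [centralGr, hn.ne'] using hk
  have h1 : contract e x vacuumForm = 0 := by
    change Finsupp.linearCombination ℂ contractBasis (e.basis.repr x) vacuumForm = 0
    rw [Finsupp.linearCombination_apply, Finsupp.sum, LinearMap.sum_apply]
    refine Finset.sum_eq_zero fun i hi => ?_
    have hd : e.deg i = n := by
      by_contra hne
      exact Finsupp.mem_support_iff.1 hi (e.repr_eq_zero h hx hne)
    rw [LinearMap.smul_apply, vacuumForm, contractBasis_notMem, smul_zero]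
    change ¬ e.deg i ≤ 0
    lia
  have h2 : wedge h e u vacuumForm = 0 := by
    change Finsupp.linearCombination ℂ wedgeBasis (e.dualCoord h u) vacuumForm = 0
    rw [Finsupp.linearCombination_apply, Finsupp.sum, LinearMap.sum_apply]
    refine Finset.sum_eq_zero fun i hi => ?_
    have hd : e.deg i = -n := by
      by_contra hne
      exact Finsupp.mem_support_iff.1 hi (hu _ hne _ (e.mem i))
    rw [LinearMap.smul_apply, vacuumForm, wedgeBasis_mem, smul_zero]
    change e.deg i ≤ 0
    lia
  rw [clOp_apply]
  simp [h1, h2, hk0]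

theorem forms_generated (h : QuasiFinite 𝓛) (P : Submodule ℂ (Forms e)) (hv : vacuumForm ∈ P)
    (hP : ∀ x, ∀ m ∈ P, clOp h e x m ∈ P) : P = ⊤ := by
  have hc : ∀ j, ∀ m ∈ P, contractBasis j m ∈ P := fun j m hm => by
    have := hP ((e.basis j, 0), 0) m hm
    simpa [clOp_apply, contract] using this
  have hw : ∀ j, ∀ m ∈ P, wedgeBasis j m ∈ P := fun j m hm => by
    have := hP ((0, e.dual h j), 0) m hm
    have hd : e.dualCoord h (e.dual h j) = Finsupp.single j 1 := by
      ext i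
      rw [e.dualCoord_apply]
      change e.basis.repr (e.basis i) j = _
      rw [e.basis.repr_self, Finsupp.single_apply, Finsupp.single_apply]
      simp only [eq_comm]
    simpa [clOp_apply, wedge, hd] using this
  have hsgn : ∀ (j : ι) (S T : SemiInfiniteSet e),
      sign j S • monomial e T ∈ P → monomial e T ∈ P := by
    intro j S T hT
    have := P.smul_mem (sign j S) hT
    rwa [smul_smul, sign_mul_sign, one_smul] at this
  have key : ∀ A : Set ι, A.Finite → ∀ S : SemiInfiniteSet e,
      (S.1 \ e.sea) ∪ (e.sea \ S.1) = A → monomial e S ∈ P := by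
    intro A hA
    induction A, hA using Set.Finite.induction_on with
    | empty =>
      intro S hS
      rw [Set.union_empty_iff, Set.sdiff_eq_empty, Set.sdiff_eq_empty] at hS
      have : S = vacuum := Subtype.ext (hS.1.antisymm hS.2)
      exact this ▸ hv
    | @insert a A ha _ ih =>
      intro S hS
      have hsea : ∀ i, (i ∈ S.1 ∧ i ∉ e.sea ∨ i ∈ e.sea ∧ i ∉ S.1) ↔ (i = a ∨ i ∈ A) :=
        fun i => Set.ext_iff.1 hS i
      by_cases haS : a ∈ S.1
      · have h1 := ih (del a S) (by
          ext i
          have := hsea i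
          have h2 := hsea a
          simp only [Set.mem_union, Set.mem_sdiff, mem_del]
          by_cases hia : i = a
          · subst hia; tauto
          · tauto)
        have h2 := hw a _ h1
        rw [wedgeBasis_notMem (by simp [mem_del]), ins_del haS] at h2
        exact hsgn _ _ _ h2
      · have h1 := ih (ins a S) (by
          ext i
          have := hsea i
          have h2 := hsea a
          simp only [Set.mem_union, Set.mem_sdiff, mem_ins]
          by_cases hia : i = a
          · subst hia; tauto
          · tauto)
        have h2 := hc a _ h1
        rw [contractBasis_mem (by simp [mem_ins]), del_ins haS] at h2
        exact hsgn _ _ _ h2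
  rw [eq_top_iff, ← (monomial e).span_eq, Submodule.span_le]
  rintro _ ⟨S, rfl⟩
  exact key _ (S.2.1.union S.2.2) S rfl

/-- `Λ^{∞/2 + •} L^*` is a smooth `cl(L)`-module. -/
theorem clRep_smooth (h : QuasiFinite 𝓛) (e : OrderedBasis 𝓛 ι) : IsSmooth (clRep h e) := by
  refine isSmooth_of_vacuum (fun x y => (clBr 𝓛 x y).2) (fun x y => ?_) (fun {m n x y} hx hy hmn => ?_)
    vacuumForm (fun hn hx => ?_) (fun P hv hP => forms_generated h P hv fun x m hm => ?_)
  · change clRep h e (Env.of (clLie h) (clBr 𝓛 x y)) = _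
    rw [clRep_of, clOp_apply]
    simp
  · rw [clBr_gr hx hy hmn]; rfl
  · rw [clRep_of]
    exact clOp_vacuum h hn hx
  · rw [← clRep_of]
    exact hP x m hm

/-- The action of `U_1(cl(L))^com` on `Λ^{∞/2 + •} L^*`. -/
def clAct (h : QuasiFinite 𝓛) (e : OrderedBasis 𝓛 ι) :
    EnvOne (clLie h) (clK 𝓛) →ₐ[ℂ] Module.End ℂ (Forms e) :=
  (clRep_smooth h e).one (by rw [clRep_of, clOp_apply]; simp [clK])

end Forms

/-! ### The Fock module and the action of `c(L)` -/

/-- The Lie algebra `ϵ(F) ⊕ ℂ K` with `[ϵ(f), ϵ(g)] = -γ(f, g) K` and `K` central; the pair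
`(f, k)` stands for `ϵ(f) + k K`. -/
def Heisenberg (C : GradedComplement γ) : Type _ := C.F × ℂ

namespace Heisenberg

variable (C : GradedComplement γ)

instance : AddCommGroup (Heisenberg C) := inferInstanceAs (AddCommGroup (C.F × ℂ))

instance : Module ℂ (Heisenberg C) := inferInstanceAs (Module ℂ (C.F × ℂ))

instance : LieRing (Heisenberg C) where
  bracket a b := ((0, -γ.form a.1 b.1) : C.F × ℂ)
  add_lie a a' b := Prod.ext (add_zero (0 : C.F)).symm (by
    change -γ.form ((a.1 + a'.1 : C.F) : L) b.1 = -γ.form a.1 b.1 + -γ.form a'.1 b.1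
    rw [Submodule.coe_add, map_add, LinearMap.add_apply]; ring)
  lie_add a b b' := Prod.ext (add_zero (0 : C.F)).symm (by
    change -γ.form a.1 ((b.1 + b'.1 : C.F) : L) = -γ.form a.1 b.1 + -γ.form a.1 b'.1
    rw [Submodule.coe_add, map_add]; ring)
  lie_self a := Prod.ext rfl (by
    change -γ.form a.1 a.1 = 0
    rw [γ.alt, neg_zero])
  leibniz_lie a b d := Prod.ext (add_zero (0 : C.F)).symm (by
    change -γ.form a.1 ((0 : C.F) : L) = -γ.form ((0 : C.F) : L) d.1 + -γ.form b.1 ((0 : C.F) : L)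
    simp)

instance : LieAlgebra ℂ (Heisenberg C) where
  lie_smul r a b := Prod.ext (by
    change (0 : C.F) = r • (0 : C.F)
    rw [smul_zero]) (by
    change -γ.form a.1 ((r • b.1 : C.F) : L) = r • (-γ.form a.1 b.1)
    rw [Submodule.coe_smul, map_smul, smul_neg])

/-- The element `ϵ(f)`. -/
def eps : C.F →ₗ[ℂ] Heisenberg C := LinearMap.inl ℂ C.F ℂ

/-- The central element `K`. -/
def K : Heisenberg C := ((0, 1) : C.F × ℂ)

theorem lie_eps (f g : C.F) : ⁅eps C f, eps C g⁆ = -γ.form f g • K C :=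
  Prod.ext (by
    change (0 : C.F) = -γ.form f g • (0 : C.F)
    rw [smul_zero]) (by
    change -γ.form f g = -γ.form f g • (1 : ℂ)
    rw [smul_eq_mul, mul_one])

theorem lie_K (a : Heisenberg C) : ⁅K C, a⁆ = 0 :=
  Prod.ext rfl (by
    change -γ.form ((0 : C.F) : L) a.1 = 0
    simp)

theorem eq_eps_add (a : Heisenberg C) : a = eps C a.1 + a.2 • K C :=
  Prod.ext (by
    change a.1 = a.1 + a.2 • (0 : C.F)
    rw [smul_zero, add_zero]) (by
    change a.2 = 0 + a.2 • (1 : ℂ)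
    simp)

/-- The left ideal of `U(ϵ(F) ⊕ ℂ K)` generated by the `ϵ(f)` with `f` of positive degree and
by `K - 1`. -/
def vacuumIdeal : Submodule (UniversalEnvelopingAlgebra ℂ (Heisenberg C))
    (UniversalEnvelopingAlgebra ℂ (Heisenberg C)) :=
  Submodule.span _ ({a | ∃ n : ℤ, 0 < n ∧ ∃ f ∈ C.gr n,
    a = UniversalEnvelopingAlgebra.ι ℂ (eps C f)} ∪ {UniversalEnvelopingAlgebra.ι ℂ (K C) - 1})

end Heisenberg

/-- The Fock module `𝔉`, i.e. the `ϵ(F) ⊕ ℂ K`-module induced from the one-dimensional module of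
the subalgebra `ϵ(F)_+ = ⨁ n > 0, ϵ(F)_n ⊕ ℂ K` on which `ϵ(F)_n` acts by zero and `K` by one:
`U(𝔥) ⊗_{U(𝔭)} ℂ_χ` is the quotient of `U(𝔥)` by the left ideal generated by the `p - χ(p)`. -/
def Fock (C : GradedComplement γ) : Type _ :=
  UniversalEnvelopingAlgebra ℂ (Heisenberg C) ⧸ Heisenberg.vacuumIdeal C

namespace Fock

variable (C : GradedComplement γ)

instance : AddCommGroup (Fock C) := inferInstanceAs (AddCommGroup (_ ⧸ Heisenberg.vacuumIdeal C))

instance : Module (UniversalEnvelopingAlgebra ℂ (Heisenberg C)) (Fock C) :=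
  inferInstanceAs (Module _ (_ ⧸ Heisenberg.vacuumIdeal C))

instance : Module ℂ (Fock C) := inferInstanceAs (Module ℂ (_ ⧸ Heisenberg.vacuumIdeal C))

instance : IsScalarTower ℂ (UniversalEnvelopingAlgebra ℂ (Heisenberg C)) (Fock C) :=
  inferInstanceAs (IsScalarTower ℂ _ (_ ⧸ Heisenberg.vacuumIdeal C))

/-- The projection from `U(ϵ(F) ⊕ ℂ K)`. -/
def mk : UniversalEnvelopingAlgebra ℂ (Heisenberg C) →ₗ[UniversalEnvelopingAlgebra ℂ (Heisenberg C)]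
    Fock C := (Heisenberg.vacuumIdeal C).mkQ

/-- The action of `ϵ(F) ⊕ ℂ K` on the Fock module. -/
def op : Heisenberg C →ₗ[ℂ] Module.End ℂ (Fock C) :=
  (Algebra.lsmul ℂ ℂ (Fock C)).toLinearMap ∘ₗ
    (UniversalEnvelopingAlgebra.ι ℂ : Heisenberg C →ₗ⁅ℂ⁆ _).toLinearMap

variable {C}

theorem op_apply (a : Heisenberg C) (m : Fock C) :
    op C a m = UniversalEnvelopingAlgebra.ι ℂ a • m := rfl

theorem heisenberg_induction {p : UniversalEnvelopingAlgebra ℂ (Heisenberg C) → Prop}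
    (add : ∀ a b, p a → p b → p (a + b)) (smul : ∀ (r : ℂ) a, p a → p (r • a)) (one : p 1)
    (mul : ∀ x a, p a → p (UniversalEnvelopingAlgebra.ι ℂ x * a))
    (a : UniversalEnvelopingAlgebra ℂ (Heisenberg C)) : p a := by
  suffices h : ∀ (t : TensorAlgebra ℂ (Heisenberg C)) b, p b →
      p (UniversalEnvelopingAlgebra.mkAlgHom ℂ (Heisenberg C) t * b) by
    obtain ⟨t, rfl⟩ : ∃ t, UniversalEnvelopingAlgebra.mkAlgHom ℂ (Heisenberg C) t = a :=
      Quotient.exists_rep a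
    simpa using h t 1 one
  intro t
  induction t using TensorAlgebra.induction with
  | algebraMap r =>
    intro b hb
    rw [AlgHom.commutes, ← Algebra.smul_def]
    exact smul r b hb
  | ι x => exact fun b hb => mul x b hb
  | mul s t hs ht =>
    intro b hb
    rw [map_mul, mul_assoc]
    exact hs _ (ht b hb)
  | add s t hs ht =>
    intro b hb
    rw [map_add, add_mul]
    exact add _ _ (hs b hb) (ht b hb)

theorem K_comm (a : UniversalEnvelopingAlgebra ℂ (Heisenberg C)) :
    UniversalEnvelopingAlgebra.ι ℂ (Heisenberg.K C) * a =
      a * UniversalEnvelopingAlgebra.ι ℂ (Heisenberg.K C) := by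
  induction a using heisenberg_induction with
  | add a b ha hb => rw [mul_add, add_mul, ha, hb]
  | smul r a ha => rw [mul_smul_comm, smul_mul_assoc, ha]
  | one => simp
  | mul x a ha =>
    have h := LieHom.map_lie (UniversalEnvelopingAlgebra.ι ℂ) (Heisenberg.K C) x
    rw [Heisenberg.lie_K, map_zero, LieRing.of_associative_ring_bracket, eq_comm, sub_eq_zero] at h
    rw [← mul_assoc, h, mul_assoc, ha, mul_assoc]

theorem op_K : op C (Heisenberg.K C) = 1 := by
  ext m
  obtain ⟨a, rfl⟩ := (Heisenberg.vacuumIdeal C).mkQ_surjective m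
  change UniversalEnvelopingAlgebra.ι ℂ (Heisenberg.K C) • mk C a = mk C a
  rw [← map_smul, smul_eq_mul, K_comm, ← sub_eq_zero, ← map_sub]
  change (Heisenberg.vacuumIdeal C).mkQ _ = 0
  rw [Submodule.mkQ_apply, Submodule.Quotient.mk_eq_zero]
  have h : UniversalEnvelopingAlgebra.ι ℂ (Heisenberg.K C) - 1 ∈ Heisenberg.vacuumIdeal C :=
    Submodule.subset_span (Or.inr rfl)
  simpa [mul_sub] using Submodule.smul_mem _ a h

theorem op_eps_comm (f g : C.F) :
    op C (Heisenberg.eps C f) * op C (Heisenberg.eps C g) =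
      op C (Heisenberg.eps C g) * op C (Heisenberg.eps C f) - γ.form f g • 1 := by
  have h := LieHom.map_lie (UniversalEnvelopingAlgebra.ι ℂ) (Heisenberg.eps C f)
    (Heisenberg.eps C g)
  rw [Heisenberg.lie_eps, LieRing.of_associative_ring_bracket, map_smul, eq_sub_iff_add_eq] at h
  have h2 := congrArg (Algebra.lsmul ℂ ℂ (Fock C)) h
  rw [map_add, map_smul, map_mul, map_mul] at h2
  have h3 : (Algebra.lsmul ℂ ℂ (Fock C)) (UniversalEnvelopingAlgebra.ι ℂ (Heisenberg.K C)) = 1 :=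
    op_K
  rw [h3, neg_smul] at h2
  refine h2.symm.trans ?_
  rw [neg_add_eq_sub]
  rfl

variable (C) in
/-- The vacuum vector of the Fock module. -/
def vacuum : Fock C := mk C 1

theorem op_vacuum {n : ℤ} (hn : 0 < n) {f : C.F} (hf : f ∈ C.gr n) :
    op C (Heisenberg.eps C f) (vacuum C) = 0 := by
  rw [op_apply, vacuum, ← map_smul, smul_eq_mul, mul_one]
  change (Heisenberg.vacuumIdeal C).mkQ _ = 0
  rw [Submodule.mkQ_apply, Submodule.Quotient.mk_eq_zero]
  exact Submodule.subset_span (Or.inl ⟨n, hn, f, hf, rfl⟩)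

theorem generated (P : Submodule ℂ (Fock C)) (hv : vacuum C ∈ P)
    (hP : ∀ f, ∀ m ∈ P, op C (Heisenberg.eps C f) m ∈ P) : P = ⊤ := by
  rw [eq_top_iff]
  intro m _
  obtain ⟨a, rfl⟩ := (Heisenberg.vacuumIdeal C).mkQ_surjective m
  change mk C a ∈ P
  induction a using heisenberg_induction with
  | add a b ha hb => rw [map_add]; exact add_mem (ha trivial) (hb trivial)
  | smul r a ha =>
    have : mk C (r • a) = r • mk C a := rfl
    rw [this]
    exact P.smul_mem r (ha trivial)
  | one => exact hv
  | mul x a ha =>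
    rw [← smul_eq_mul, map_smul]
    change op C x (mk C a) ∈ P
    rw [Heisenberg.eq_eps_add C x, map_add, map_smul, op_K]
    exact add_mem (hP _ _ (ha trivial)) (P.smul_mem _ (ha trivial))

end Fock

open scoped TensorProduct

section Action

variable {ι : Type*} [LinearOrder ι]

/-- The space `Λ^{∞/2 + •} L^* ⊗ 𝔉`. -/
abbrev FormsFock (e : OrderedBasis 𝓛 ι) (C : GradedComplement γ) : Type _ :=
  Forms e ⊗[ℂ] Fock C

/-- The operator of an element of `c(L)` on `Λ^{∞/2 + •} L^* ⊗ 𝔉`: the elements of `cl(L)` act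
on the first factor, those of `ϵ(F)` on the second. -/
def cOp (h : QuasiFinite 𝓛) (e : OrderedBasis 𝓛 ι) (C : GradedComplement γ) :
    CSpace C →ₗ[ℂ] Module.End ℂ (FormsFock e C) :=
  ((LinearMap.rTensorHom (Fock C)) ∘ₗ clOp h e).coprod
    ((LinearMap.lTensorHom (Forms e)) ∘ₗ Fock.op C ∘ₗ Heisenberg.eps C)

variable {e : OrderedBasis 𝓛 ι} {C : GradedComplement γ}

theorem cOp_apply (h : QuasiFinite 𝓛) (x : CSpace C) :
    cOp h e C x = (clOp h e x.1).rTensor (Fock C) +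
      (Fock.op C (Heisenberg.eps C x.2)).lTensor (Forms e) := rfl

theorem cOp_tmul (h : QuasiFinite 𝓛) (x : CSpace C) (ω : Forms e) (m : Fock C) :
    cOp h e C x (ω ⊗ₜ m) = clOp h e x.1 ω ⊗ₜ m + ω ⊗ₜ Fock.op C (Heisenberg.eps C x.2) m := rfl

theorem clOp_K (h : QuasiFinite 𝓛) : clOp h e (clK 𝓛) = 1 := by
  rw [clOp_apply]; simp [clK]

theorem cOp_mul (h : QuasiFinite 𝓛) {i j : ZMod 2} {x y : CSpace C} (hx : x ∈ cPar C i)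
    (hy : y ∈ cPar C j) :
    cOp h e C x * cOp h e C y = koszul i j • (cOp h e C y * cOp h e C x) +
      cOp h e C (cBr C x y) := by
  have hbr : cOp h e C (cBr C x y) =
      (clOp h e (clBr 𝓛 x.1 y.1)).rTensor (Fock C) - γ.form x.2 y.2 • 1 := by
    refine TensorProduct.ext' fun ω m => ?_
    rw [cOp_tmul, cBr_apply, map_sub, map_smul, clOp_K]
    simp [TensorProduct.sub_tmul, TensorProduct.smul_tmul']
  have h1 : (clOp h e x.1).rTensor (Fock C) * (clOp h e y.1).rTensor (Fock C) =
      koszul i j • ((clOp h e y.1).rTensor (Fock C) * (clOp h e x.1).rTensor (Fock C)) +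
        (clOp h e (clBr 𝓛 x.1 y.1)).rTensor (Fock C) := by
    refine TensorProduct.ext' fun ω m => ?_
    have := congrArg (fun A => A ω ⊗ₜ[ℂ] m) (clOp_mul (e := e) h (i := i) (j := j) hx.1 hy.1)
    simpa [TensorProduct.add_tmul, TensorProduct.smul_tmul'] using this
  have h2 : (Fock.op C (Heisenberg.eps C x.2)).lTensor (Forms e) *
      (Fock.op C (Heisenberg.eps C y.2)).lTensor (Forms e) =
      (Fock.op C (Heisenberg.eps C y.2)).lTensor (Forms e) *
        (Fock.op C (Heisenberg.eps C x.2)).lTensor (Forms e) - γ.form x.2 y.2 • 1 := by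
    refine TensorProduct.ext' fun ω m => ?_
    have := congrArg (fun A => ω ⊗ₜ[ℂ] A m) (Fock.op_eps_comm x.2 y.2)
    simpa [TensorProduct.tmul_sub] using this
  have hcomm : ∀ (A : Module.End ℂ (Forms e)) (B : Module.End ℂ (Fock C)),
      A.rTensor (Fock C) * B.lTensor (Forms e) = B.lTensor (Forms e) * A.rTensor (Fock C) :=
    fun A B => TensorProduct.ext' fun ω m => rfl
  rw [hbr, cOp_apply, cOp_apply]
  by_cases hij : i = 1 ∧ j = 1
  · obtain ⟨rfl, rfl⟩ := hij
    rw [mem_cPar_one] at hx hy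
    rw [hx.2, hy.2] at *
    simpa using h1
  · have hk : koszul i j = 1 := by
      induction i using zmod_two_cases <;> induction j using zmod_two_cases <;>
        simp_all [koszul]
    rw [hk, one_smul] at h1 ⊢
    simp only [mul_add, add_mul, h1, h2, hcomm]
    abel

/-- The action of `U(c(L))` on `Λ^{∞/2 + •} L^* ⊗ 𝔉`. -/
def cRep (h : QuasiFinite 𝓛) (e : OrderedBasis 𝓛 ι) (C : GradedComplement γ) :
    Env (cLie h C) →ₐ[ℂ] Module.End ℂ (FormsFock e C) :=
  Env.lift (cOp h e C) (cOp_mul h)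

theorem cRep_of (h : QuasiFinite 𝓛) (x : CSpace C) :
    cRep h e C (Env.of (cLie h C) x) = cOp h e C x := Env.lift_of _ _ _

/-- `Λ^{∞/2 + •} L^* ⊗ 𝔉` is a smooth `c(L)`-module. -/
theorem cRep_smooth (h : QuasiFinite 𝓛) (e : OrderedBasis 𝓛 ι) (C : GradedComplement γ) :
    IsSmooth (cRep h e C) := by
  refine isSmooth_of_vacuum (fun x y => (cBr C x y).1.2) (fun x y => ?_)
    (fun {m n x y} hx hy hmn => ?_) (vacuumForm ⊗ₜ Fock.vacuum C) (fun {n x} hn hx => ?_)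
    (fun P hv hP => ?_)
  · change cRep h e C (Env.of (cLie h C) (cBr C x y)) = _
    rw [cRep_of]
    have : cBr C x y = (cBr C x y).1.2 • (clK 𝓛, 0) := by ext <;> simp [clK]
    conv_lhs => rw [this, map_smul]
    congr 1
    refine TensorProduct.ext' fun ω m => ?_
    rw [cOp_tmul, clOp_K, map_zero, map_zero]
    simp
  · rw [cBr_gr hx hy hmn]; rfl
  · rw [cRep_of, cOp_tmul, clOp_vacuum h hn hx.1, Fock.op_vacuum hn hx.2]
    simp
  · have hP' : ∀ x, ∀ m ∈ P, cOp h e C x m ∈ P := fun x m hm => by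
      rw [← cRep_of]
      exact hP x m hm
    have h1 : ∀ ω : Forms e, ω ⊗ₜ[ℂ] Fock.vacuum C ∈ P := by
      have : P.comap ((TensorProduct.mk ℂ (Forms e) (Fock C)).flip (Fock.vacuum C)) = ⊤ := by
        refine forms_generated h _ hv fun x m hm => ?_
        have := hP' (x, 0) _ hm
        simpa [cOp_tmul] using this
      intro ω
      have hω : ω ∈ (⊤ : Submodule ℂ (Forms e)) := trivial
      rw [← this] at hω
      exact hω
    have h2 : ∀ (ω : Forms e) (m : Fock C), ω ⊗ₜ[ℂ] m ∈ P := by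
      intro ω m
      have : P.comap (TensorProduct.mk ℂ (Forms e) (Fock C) ω) = ⊤ := by
        refine Fock.generated _ (h1 ω) fun f m hm => ?_
        have := hP' (0, f) _ hm
        simpa [cOp_tmul] using this
      have hm : m ∈ (⊤ : Submodule ℂ (Fock C)) := trivial
      rw [← this] at hm
      exact hm
    rw [eq_top_iff, ← TensorProduct.span_tmul_eq_top, Submodule.span_le]
    rintro _ ⟨ω, m, rfl⟩
    exact h2 ω m

/-- The action of `U_1(c(L))^com` on `Λ^{∞/2 + •} L^* ⊗ 𝔉`. -/
def cAct (h : QuasiFinite 𝓛) (e : OrderedBasis 𝓛 ι) (C : GradedComplement γ) :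
    EnvOne (cLie h C) (cK C) →ₐ[ℂ] Module.End ℂ (FormsFock e C) :=
  (cRep_smooth h e C).one (by
    rw [cRep_of]
    refine TensorProduct.ext' fun ω m => ?_
    rw [cOp_tmul, cK, clOp_K, map_zero, map_zero]
    simp)

end Action

/-! ### The elements `ρ(x)`, the cocycle `γ`, and the elements `ρ̄(x)` -/

section Rho

variable {ι : Type*} [LinearOrder ι]

open Classical in
/-- The normal ordered product `:ι(e_i) ε(e_j^*):`, in an algebra that receives maps `ι` and `ε`
from `L` and `L^*`. -/
def normalOrdered {A : Type*} [Ring A] [Algebra ℂ A] (h : QuasiFinite 𝓛) (e : OrderedBasis 𝓛 ι)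
    (io : L →ₗ[ℂ] A) (ep : restrictedDual 𝓛 →ₗ[ℂ] A) (i j : ι) : A :=
  if i = j ∧ 0 < e.deg j then -(ep (e.dual h j) * io (e.basis i))
  else io (e.basis i) * ep (e.dual h j)

/-- The term `:ι(ad x (e_j)) ε(e_j^*):` of the series that defines `ρ(x)`. -/
def rhoTerm {A : Type*} [Ring A] [Algebra ℂ A] (h : QuasiFinite 𝓛) (e : OrderedBasis 𝓛 ι)
    (io : L →ₗ[ℂ] A) (ep : restrictedDual 𝓛 →ₗ[ℂ] A) (x : L) (j : ι) : A :=
  (e.basis.repr ⁅x, e.basis j⁆).sum fun i r => r • normalOrdered h e io ep i j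

/-- The terms of the series `∑ :ι(ad x (e_j)) ε(e_j^*):` in `U(cl(L))^com`. -/
def clTerm (h : QuasiFinite 𝓛) (e : OrderedBasis 𝓛 ι) (x : L) (j : ι) : EnvCom (clLie h) :=
  rhoTerm h e (EnvCom.of (clLie h) ∘ₗ LinearMap.inl ℂ _ _ ∘ₗ LinearMap.inl ℂ _ _)
    (EnvCom.of (clLie h) ∘ₗ LinearMap.inl ℂ _ _ ∘ₗ LinearMap.inr ℂ _ _) x j

/-- The element `ρ^β(x) = ∑ :ι(ad x (e_j)) ε(e_j^*): + β(x)` of `U_1(cl(L))^com`. -/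
def rho (h : QuasiFinite 𝓛) (e : OrderedBasis 𝓛 ι) (β : Module.Dual ℂ L) (x : L) :
    EnvOne (clLie h) (clK 𝓛) :=
  EnvOne.mk (clLie h) (clK 𝓛) (∑' j, clTerm h e x j) + algebraMap ℂ _ (β x)

/-- The element `[ρ^β(x), ρ^β(y)] - ρ^β([x, y])` of `U_1(cl(L))^com`. -/
def gammaElement (h : QuasiFinite 𝓛) (e : OrderedBasis 𝓛 ι) (β : Module.Dual ℂ L) (x y : L) :
    EnvOne (clLie h) (clK 𝓛) :=
  rho h e β x * rho h e β y - rho h e β y * rho h e β x - rho h e β ⁅x, y⁆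

open Classical in
/-- The cocycle `γ^β`: the scalar valued form with
`[ρ^β(x), ρ^β(y)] - ρ^β([x, y]) = γ^β(x, y)` in `U_1(cl(L))^com`. -/
def gamma (h : QuasiFinite 𝓛) (e : OrderedBasis 𝓛 ι) (β : Module.Dual ℂ L) : GradedAltForm 𝓛 :=
  if H : ∃ γ : GradedAltForm 𝓛, ∀ x y, gammaElement h e β x y = algebraMap ℂ _ (γ.form x y)
  then H.choose else 0

/-- The terms of the series `∑ :ι(ad x (e_j)) ε(e_j^*):` in `U(c(L))^com`. -/
def cTerm (h : QuasiFinite 𝓛) (e : OrderedBasis 𝓛 ι) (C : GradedComplement γ) (x : L) (j : ι) :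
    EnvCom (cLie h C) :=
  rhoTerm h e
    (EnvCom.of (cLie h C) ∘ₗ LinearMap.inl ℂ _ _ ∘ₗ LinearMap.inl ℂ _ _ ∘ₗ LinearMap.inl ℂ _ _)
    (EnvCom.of (cLie h C) ∘ₗ LinearMap.inl ℂ _ _ ∘ₗ LinearMap.inl ℂ _ _ ∘ₗ LinearMap.inr ℂ _ _)
    x j

/-- The element `ϵ(x)` of `c(L)`: the projection of `x` to `F` along the radical of `γ`. -/
def GradedComplement.eps (C : GradedComplement γ) : L →ₗ[ℂ] CSpace C :=
  LinearMap.inr ℂ _ _ ∘ₗ Submodule.projectionOnto C.F (LinearMap.ker γ.form) C.isCompl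

/-- The element `ρ̄^β(x) = ρ^β(x) + ϵ(x)` of `U_1(c(L))^com`, where `ρ^β(x)` is given in `c(L)`
by the same series as in its subalgebra `cl(L)`. -/
def rhoBar (h : QuasiFinite 𝓛) (e : OrderedBasis 𝓛 ι) (β : Module.Dual ℂ L)
    (C : GradedComplement (gamma h e β)) (x : L) : EnvOne (cLie h C) (cK C) :=
  EnvOne.mk (cLie h C) (cK C) (∑' j, cTerm h e C x j) + algebraMap ℂ _ (β x) +
    EnvOne.mk (cLie h C) (cK C) (EnvCom.of (cLie h C) (C.eps x))

end Rho

end SemiInfinite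

end

noncomputable section

namespace SemiInfinite

open Topology

/-! ### Band matrices with respect to an ordered homogeneous basis -/

section Band

variable {L : Type*} [LieRing L] [LieAlgebra ℂ L] {𝓛 : ℤ → Submodule ℂ L}
  {ι : Type*} [LinearOrder ι]

/-! Write `N i j` for the normal ordered product of `ι(e_i)` and `ε(e_j^*)`, and `N(a)` for the sum
of `a i j • N i j`. Then `ρ^β(x)` is `N(ad x) + β(x)`, where the matrix of `ad x` is a band matrix:
its nonzero entries join indices whose degrees differ by a bounded amount.

Without normal ordering, the products `ι(e_i) ε(e_j^*)` satisfy the commutation relations of matrix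
units, up to a factor `K`. Normal ordering subtracts `K` from the diagonal products of positive
degree. The subtracted elements commute with all these products, so they do not change a commutator.
They do reappear when its value is rewritten in normal ordered form, and this gives `[N(a), N(b)] =
K N([a, b]) + c(a, b) K²`, where `c` is `bandCocycle`. The sum `c(a, b)` is finite because only
pairs of indices on opposite sides of degree zero contribute. `IsClifford.commutator_normalOrdered`
is the case of single products and `IsClifford.commutator_bandSum` that of infinite sums.

Convergence rests on decay (`IsCliffordIn.vanishesAtInfinity`). Inside a band, far from degree zero,
`N i j` can be written with a rightmost factor of large degree, and in a complete nonarchimedean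
group a family whose terms tend to zero is summable. All limits are taken in `U(S)^com`, where `K`
is not yet `1`; only the resulting identity is projected to `U_1(S)^com`. The argument is carried
out for any superalgebra `S` that contains the relations of `cl(L)`, hence for `cl(L)` and `c(L)` at
once.

With `K = 1` the defect of `ρ^β` is the scalar `c(ad x, ad y) - β([x, y])`. Scalars embed in
`U_1(cl(L))^com`, since it acts on the nonzero vacuum form, so this scalar is `γ^β(x, y)`. In
`c(L)`, the elements `ϵ(x)` commute with the series and have commutator `-γ^β(x, y)`, which cancels
the defect. If brackets lie in the radical, then `ϵ([x, y]) = 0`, and `ρ̄^β` is a homomorphism.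
Conversely, an `L`-module structure on the forms by `ρ^β` would make the scalars `γ^β(x, y)` kill
the vacuum. -/

/-- A matrix is a band matrix if its entries vanish unless the degrees of their indices differ by
at most some bound. -/
def IsBand (e : OrderedBasis 𝓛 ι) (a : ι → ι → ℂ) : Prop :=
  ∃ M : ℤ, ∀ i j, a i j ≠ 0 → |e.deg i - e.deg j| ≤ M

variable {e : OrderedBasis 𝓛 ι}

theorem OrderedBasis.finite_deg_mem (h : QuasiFinite 𝓛) (e : OrderedBasis 𝓛 ι) {s : Set ℤ}
    (hs : s.Finite) : (e.deg ⁻¹' s).Finite :=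
  hs.preimage' fun n _ => e.finite_fiber h n

theorem OrderedBasis.finite_near (h : QuasiFinite 𝓛) (e : OrderedBasis 𝓛 ι) (d M : ℤ) :
    {i | |e.deg i - d| ≤ M}.Finite :=
  (e.finite_deg_mem h (Set.finite_Icc (d - M) (d + M))).subset fun i hi => by
    have := abs_le.1 (show |e.deg i - d| ≤ M from hi)
    exact ⟨by linarith, by linarith⟩

theorem OrderedBasis.finite_near_pair (h : QuasiFinite 𝓛) (e : OrderedBasis 𝓛 ι) (M a b : ℤ) :
    {p : ι × ι | |e.deg p.1 - e.deg p.2| ≤ M ∧ a ≤ e.deg p.2 ∧ e.deg p.2 ≤ b}.Finite := by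
  refine ((e.finite_deg_mem h (Set.finite_Icc (a - M) (b + M))).prod
    (e.finite_deg_mem h (Set.finite_Icc a b))).subset ?_
  rintro ⟨i, j⟩ ⟨h1, h2, h3⟩
  have := abs_le.1 h1
  dsimp only at *
  exact ⟨⟨by linarith, by linarith⟩, h2, h3⟩

theorem IsBand.finite_col (h : QuasiFinite 𝓛) {a : ι → ι → ℂ} (ha : IsBand e a) (j : ι) :
    {i | a i j ≠ 0}.Finite := by
  obtain ⟨M, hM⟩ := ha
  exact (e.finite_near h (e.deg j) M).subset fun i hi => hM i j hi

theorem IsBand.finite_row (h : QuasiFinite 𝓛) {a : ι → ι → ℂ} (ha : IsBand e a) (i : ι) :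
    {j | a i j ≠ 0}.Finite := by
  obtain ⟨M, hM⟩ := ha
  refine (e.finite_near h (e.deg i) M).subset fun j hj => ?_
  have := hM i j hj
  rwa [abs_sub_comm] at this

theorem IsBand.mul {a b : ι → ι → ℂ} (ha : IsBand e a) (hb : IsBand e b) :
    IsBand e fun i l => ∑ᶠ k, a i k * b k l := by
  obtain ⟨M, hM⟩ := ha
  obtain ⟨M', hM'⟩ := hb
  refine ⟨M + M', fun i l hil => ?_⟩
  obtain ⟨k, hk⟩ : ∃ k, a i k * b k l ≠ 0 := by
    by_contra! h0
    exact hil (finsum_eq_zero_of_forall_eq_zero h0)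
  exact (abs_sub_le _ (e.deg k) _).trans
    (add_le_add (hM _ _ (left_ne_zero_of_mul hk)) (hM' _ _ (right_ne_zero_of_mul hk)))

/-! ### Structure constants of `L` as band matrices. -/

/-- The matrix of `ad x` in the basis `(e_i)`. -/
def adMatrix (e : OrderedBasis 𝓛 ι) (x : L) (i j : ι) : ℂ := e.basis.repr ⁅x, e.basis j⁆ i

theorem adMatrix_eq_zero (h : QuasiFinite 𝓛) {m : ℤ} {x : L} (hx : x ∈ 𝓛 m) {i j : ι}
    (hij : e.deg i ≠ m + e.deg j) : adMatrix e x i j = 0 :=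
  e.repr_eq_zero h (h.lie_mem hx (e.mem j)) hij

theorem adMatrix_add (x y : L) (i j : ι) :
    adMatrix e (x + y) i j = adMatrix e x i j + adMatrix e y i j := by
  simp [adMatrix]

/-- For `x` of degree `n` the matrix lives on a single shifted diagonal, of width `|n|`; a general
`x` has finitely many homogeneous components. -/
theorem isBand_adMatrix (h : QuasiFinite 𝓛) (e : OrderedBasis 𝓛 ι) (x : L) :
    IsBand e (adMatrix e x) := by
  have hx : x ∈ ⨆ n, 𝓛 n := by rw [h.internal.submodule_iSup_eq_top]; trivial
  induction hx using Submodule.iSup_induction' with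
  | mem n x hx =>
    refine ⟨|n|, fun i j hij => ?_⟩
    have : e.deg i = n + e.deg j := by
      by_contra hne
      exact hij (adMatrix_eq_zero h hx hne)
    rw [this, add_sub_cancel_right]
  | zero => exact ⟨0, fun i j hij => absurd (by simp [adMatrix]) hij⟩
  | add x y _ _ hx hy =>
    obtain ⟨M, hM⟩ := hx
    obtain ⟨M', hM'⟩ := hy
    refine ⟨max M M', fun i j hij => ?_⟩
    rw [adMatrix_add] at hij
    by_cases h0 : adMatrix e x i j = 0
    · rw [h0, zero_add] at hij
      exact (hM' i j hij).trans (le_max_right _ _)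
    · exact (hM i j h0).trans (le_max_left _ _)

theorem repr_lie_lie (x y : L) (i l : ι) :
    e.basis.repr ⁅x, ⁅y, e.basis l⁆⁆ i = ∑ᶠ k, adMatrix e x i k * adMatrix e y k l := by
  -- A `finsum` with infinite support would be zero by default; here the expansion of `[y, e_l]`
  -- confines the support to a finite set.
  rw [finsum_eq_sum_of_support_subset (s := (e.basis.repr ⁅y, e.basis l⁆).support)]
  · conv_lhs => rw [← e.basis.linearCombination_repr ⁅y, e.basis l⁆,
      Finsupp.linearCombination_apply, Finsupp.sum, lie_sum, map_sum, Finsupp.finsetSum_apply]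
    refine Finset.sum_congr rfl fun k _ => ?_
    simp [adMatrix, mul_comm]
  · intro k hk
    simp only [Function.mem_support, ne_eq, mul_eq_zero, not_or] at hk
    exact Finsupp.mem_support_iff.2 hk.2

theorem adMatrix_lie (x y : L) (i l : ι) :
    adMatrix e ⁅x, y⁆ i l = ∑ᶠ k, adMatrix e x i k * adMatrix e y k l -
      ∑ᶠ k, adMatrix e y i k * adMatrix e x k l := by
  rw [← repr_lie_lie, ← repr_lie_lie, adMatrix, lie_lie, map_sub, Finsupp.sub_apply]

/-! ### The cocycle of normal ordering on band matrices. -/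

open Classical in
/-- The indicator of the indices of positive degree. -/
def OrderedBasis.pos (e : OrderedBasis 𝓛 ι) (i : ι) : ℂ := if 0 < e.deg i then 1 else 0

/-- The cocycle that measures the failure of normal ordered quadratic expressions to be closed
under commutators. -/
def bandCocycle (e : OrderedBasis 𝓛 ι) (a b : ι → ι → ℂ) : ℂ :=
  ∑ᶠ p : ι × ι, (e.pos p.2 - e.pos p.1) * (a p.2 p.1 * b p.1 p.2)

/-- The factor `e.pos p.2 - e.pos p.1` vanishes unless exactly one of the two degrees is positive.
In a band of width `M` this forces both to be near zero, which leaves finitely many pairs. A bound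
on one of the two matrices suffices. -/
theorem bandCocycle_support_finite (h : QuasiFinite 𝓛) {a b : ι → ι → ℂ} (hb : IsBand e b) :
    (Function.support fun p : ι × ι =>
      (e.pos p.2 - e.pos p.1) * (a p.2 p.1 * b p.1 p.2)).Finite := by
  obtain ⟨M, hM⟩ := hb
  refine (e.finite_near_pair h M (-M) M).subset ?_
  rintro ⟨i, j⟩ hij
  simp only [Function.mem_support, ne_eq, mul_eq_zero, not_or] at hij
  have h1 := hM i j hij.2.2
  have h2 := abs_le.1 h1
  have h3 : ¬ (0 < e.deg i ↔ 0 < e.deg j) := fun hiff => hij.1 (by simp [OrderedBasis.pos, hiff])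
  refine ⟨h1, ?_⟩
  dsimp only at *
  -- If the degree of `j` is beyond `±M`, that of `i` lies on the same side of zero.
  constructor <;> by_contra hlt <;> refine h3 ?_ <;> constructor <;> intro <;> linarith

/-- A product of an entry and a transposed entry describes a closed path of indices; the first step
shifts the degree by `m`, the second by `n`, so the path closes only if `m + n = 0`. -/
theorem bandCocycle_adMatrix_eq_zero (h : QuasiFinite 𝓛) {m n : ℤ} {x y : L} (hx : x ∈ 𝓛 m)
    (hy : y ∈ 𝓛 n) (hmn : m + n ≠ 0) :
    bandCocycle e (adMatrix e x) (adMatrix e y) = 0 := by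
  refine finsum_eq_zero_of_forall_eq_zero fun p => ?_
  by_cases h1 : e.deg p.2 = m + e.deg p.1
  · rw [adMatrix_eq_zero h hy (i := p.1) (j := p.2) (by lia), mul_zero, mul_zero]
  · rw [adMatrix_eq_zero h hx h1, zero_mul, mul_zero]

end Band

/-! ### Normal ordered quadratic expressions in a complete ring -/

section Clifford

variable {L : Type*} [LieRing L] [LieAlgebra ℂ L] {𝓛 : ℤ → Submodule ℂ L}

/-- Maps `ι` and `ε` from `L` and `L^*` to an algebra, and an element `K`, that satisfy the
relations of `cl(L)`. -/
structure IsClifford {A : Type*} [Ring A] [Algebra ℂ A] (io : L →ₗ[ℂ] A)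
    (ep : restrictedDual 𝓛 →ₗ[ℂ] A) (K : A) : Prop where
  io_io : ∀ x y, io x * io y = -(io y * io x)
  ep_ep : ∀ u v, ep u * ep v = -(ep v * ep u)
  io_ep : ∀ x u, io x * ep u = pairing 𝓛 u x • K - ep u * io x
  K_io : ∀ x, K * io x = io x * K
  K_ep : ∀ u, K * ep u = ep u * K

variable {A : Type*} [Ring A] [Algebra ℂ A] {io : L →ₗ[ℂ] A} {ep : restrictedDual 𝓛 →ₗ[ℂ] A}
  {K : A}

/-- Moving the inner `ε` past the inner `ι` in each product yields a quadratic term with a factor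
`K` and a quartic remainder. The two remainders agree after one sign change for the `ι`'s and one
for the `ε`'s, so they cancel. -/
theorem IsClifford.commutator (hc : IsClifford io ep K) (x y : L) (u v : restrictedDual 𝓛) :
    io x * ep u * (io y * ep v) - io y * ep v * (io x * ep u) =
      K * (pairing 𝓛 u y • (io x * ep v) - pairing 𝓛 v x • (io y * ep u)) := by
  have h1 : io x * ep u * (io y * ep v) =
      pairing 𝓛 u y • (K * (io x * ep v)) - io x * io y * (ep u * ep v) := by
    have h := hc.io_ep y u
    rw [eq_sub_iff_add_eq, ← eq_sub_iff_add_eq'] at h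
    calc io x * ep u * (io y * ep v) = io x * (ep u * io y) * ep v := by noncomm_ring
      _ = _ := by
        rw [h, mul_sub, sub_mul, mul_smul_comm, smul_mul_assoc, ← hc.K_io]
        noncomm_ring
  have h2 : io y * ep v * (io x * ep u) =
      pairing 𝓛 v x • (K * (io y * ep u)) - io y * io x * (ep v * ep u) := by
    have h := hc.io_ep x v
    rw [eq_sub_iff_add_eq, ← eq_sub_iff_add_eq'] at h
    calc io y * ep v * (io x * ep u) = io y * (ep v * io x) * ep u := by noncomm_ring
      _ = _ := by
        rw [h, mul_sub, sub_mul, mul_smul_comm, smul_mul_assoc, ← hc.K_io]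
        noncomm_ring
  rw [h1, h2, hc.io_io x y, hc.ep_ep u v, neg_mul_neg, sub_sub_sub_cancel_right, mul_sub,
    mul_smul_comm, mul_smul_comm]

variable {ι : Type*} [LinearOrder ι] {e : OrderedBasis 𝓛 ι}

theorem pairing_dual (h : QuasiFinite 𝓛) (i j : ι) [Decidable (i = j)] :
    pairing 𝓛 (e.dual h j) (e.basis i) = if i = j then 1 else 0 := by
  change e.basis.repr (e.basis i) j = _
  rw [e.basis.repr_self, Finsupp.single_apply]

-- The anticommutation relation turns `-ε ι` into `ι ε - K` on the diagonal in positive degree;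
-- elsewhere normal ordering changes nothing.
open Classical in
theorem IsClifford.normalOrdered_eq (h : QuasiFinite 𝓛) (hc : IsClifford io ep K) (i j : ι) :
    normalOrdered h e io ep i j =
      io (e.basis i) * ep (e.dual h j) - (if i = j then e.pos j else 0) • K := by
  rw [normalOrdered]
  by_cases hij : i = j
  · subst hij
    by_cases hp : 0 < e.deg i
    · rw [hc.io_ep, pairing_dual]
      simp [hp, OrderedBasis.pos]
    · simp [hp, OrderedBasis.pos]
  · simp [hij]

-- This is the origin of the cocycle. The corrections by multiples of `K` drop out of the left side.
-- On the right, the two quadratic terms need a correction `e.pos l • K` if `i = l` and `e.pos k •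
-- K` if `j = k`. Both terms are present with a correction exactly when `j = k` and `i = l`, and the
-- difference remains.
open Classical in
theorem IsClifford.commutator_normalOrdered (h : QuasiFinite 𝓛) (hc : IsClifford io ep K)
    (i j k l : ι) :
    normalOrdered h e io ep i j * normalOrdered h e io ep k l -
        normalOrdered h e io ep k l * normalOrdered h e io ep i j =
      (if j = k then K * normalOrdered h e io ep i l else 0) -
        (if i = l then K * normalOrdered h e io ep k j else 0) +
        (if j = k ∧ i = l then e.pos l - e.pos k else 0) • (K * K) := by
  have hK : ∀ x u, K * (io x * ep u) = io x * ep u * K := fun x u => by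
    rw [← mul_assoc, hc.K_io, mul_assoc, hc.K_ep, mul_assoc]
  have hcomm := hc.commutator (e.basis i) (e.basis k) (e.dual h j) (e.dual h l)
  rw [pairing_dual, pairing_dual] at hcomm
  have hleft : normalOrdered h e io ep i j * normalOrdered h e io ep k l -
        normalOrdered h e io ep k l * normalOrdered h e io ep i j =
      io (e.basis i) * ep (e.dual h j) * (io (e.basis k) * ep (e.dual h l)) -
        io (e.basis k) * ep (e.dual h l) * (io (e.basis i) * ep (e.dual h j)) := by
    simp only [hc.normalOrdered_eq h, sub_mul, mul_sub, smul_mul_assoc, mul_smul_comm, hK]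
    module
  rw [hleft, hcomm]
  simp only [hc.normalOrdered_eq h, mul_sub, mul_smul_comm]
  by_cases hjk : j = k <;> by_cases hil : i = l
  · subst hjk hil
    simp only [if_true, and_self]
    module
  · subst hjk
    simp [hil]
  · subst hil
    simp [hjk, Ne.symm hjk]
  · simp [hjk, hil, Ne.symm hjk]

end Clifford

/-! ### Convergence and commutators of infinite normal ordered sums. -/

section Summation

variable {L : Type*} [LieRing L] [LieAlgebra ℂ L] {𝓛 : ℤ → Submodule ℂ L}
  {ι : Type*} [LinearOrder ι] {e : OrderedBasis 𝓛 ι}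
  {A : Type*} [Ring A] [Algebra ℂ A] [UniformSpace A]

/-- A family of vectors indexed by pairs vanishes at infinity if, in every band around the diagonal,
all but finitely many of the lines it spans lie in a given neighbourhood of zero. -/
def VanishesAtInfinity (e : OrderedBasis 𝓛 ι) (N : ι → ι → A) : Prop :=
  ∀ M : ℤ, ∀ U ∈ 𝓝 (0 : A),
    {p : ι × ι | |e.deg p.1 - e.deg p.2| ≤ M ∧ ∃ c : ℂ, c • N p.1 p.2 ∉ U}.Finite

/-- The sum `∑ a_{ij} N_{ij}`. -/
def bandSum (N : ι → ι → A) (a : ι → ι → ℂ) : A := ∑' p : ι × ι, a p.1 p.2 • N p.1 p.2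

theorem hasSum_finsum_of_finite {κ B : Type*} [AddCommMonoid B] [TopologicalSpace B] {f : κ → B}
    (hf : (Function.support f).Finite) : HasSum f (∑ᶠ k, f k) := by
  rw [finsum_eq_sum f hf]
  exact hasSum_sum_of_ne_finset_zero fun k hk => by simpa using hk

theorem finsum_smul_of_finite {κ B : Type*} [AddCommGroup B] [Module ℂ B] {c : κ → ℂ}
    (hc : (Function.support c).Finite) (v : B) : (∑ᶠ k, c k) • v = ∑ᶠ k, c k • v :=
  ((LinearMap.toSpanSingleton ℂ B v).toAddMonoidHom.map_finsum hc :)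

variable [IsUniformAddGroup A] [NonarchimedeanAddGroup A] [CompleteSpace A]

/-- In a complete nonarchimedean group it suffices that the terms tend to zero. The family is
indexed through a map `f` with finite fibres on the support of `c`, so that the criterion covers
both single sums over pairs and the sums over triples that come from matrix products. The
coefficients `c k` are unbounded, which is why decay is required of whole lines. -/
theorem VanishesAtInfinity.summable {N : ι → ι → A} (hN : VanishesAtInfinity e N) {κ : Type*}
    (f : κ → ι × ι) (c : κ → ℂ) {M : ℤ}
    (hM : ∀ k, c k ≠ 0 → |e.deg (f k).1 - e.deg (f k).2| ≤ M)
    (hfin : ∀ p, {k | f k = p ∧ c k ≠ 0}.Finite) :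
    Summable fun k => c k • N (f k).1 (f k).2 := by
  refine NonarchimedeanAddGroup.summable_of_tendsto_cofinite_zero ?_
  intro U hU
  refine ((hN M U hU).biUnion fun p _ => hfin p).subset fun k hk => ?_
  have hk' : c k • N (f k).1 (f k).2 ∉ U := hk
  have hc : c k ≠ 0 := by
    intro h0
    rw [h0, zero_smul] at hk'
    exact hk' (mem_of_mem_nhds hU)
  exact Set.mem_biUnion (x := f k) ⟨hM k hc, c k, hk'⟩ ⟨rfl, hc⟩

theorem VanishesAtInfinity.hasSum_bandSum {N : ι → ι → A} (hN : VanishesAtInfinity e N)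
    {a : ι → ι → ℂ} (ha : IsBand e a) :
    HasSum (fun p : ι × ι => a p.1 p.2 • N p.1 p.2) (bandSum N a) := by
  obtain ⟨M, hM⟩ := ha
  exact (hN.summable (κ := ι × ι) id (fun p => a p.1 p.2) (fun p hp => hM _ _ hp)
    fun p => (Set.finite_singleton p).subset fun q hq => hq.1).hasSum

/-- The series for `ρ` is the unconditionally convergent double sum `N(ad x)`, evaluated column by
column; each column is a finite sum. -/
theorem hasSum_rhoTerm (h : QuasiFinite 𝓛) {io : L →ₗ[ℂ] A}
    {ep : restrictedDual 𝓛 →ₗ[ℂ] A} (hN : VanishesAtInfinity e (normalOrdered h e io ep))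
    (x : L) :
    HasSum (rhoTerm h e io ep x) (bandSum (normalOrdered h e io ep) (adMatrix e x)) := by
  have h1 := hN.hasSum_bandSum (isBand_adMatrix h e x)
  refine ((Equiv.prodComm ι ι).hasSum_iff.2 h1).prod_fiberwise fun j => ?_
  exact hasSum_sum_of_ne_finset_zero fun i hi => by
    simp only [Finsupp.mem_support_iff, not_not] at hi
    simp [adMatrix, hi]

variable [T2Space A]

/-- One summable family over triples `(i, l, k)`. Summing over `k` first gives `N` of the matrix
product; the next two lemmas group the same family differently. -/
theorem VanishesAtInfinity.hasSum_mul (h : QuasiFinite 𝓛) {N : ι → ι → A}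
    (hN : VanishesAtInfinity e N) {a b : ι → ι → ℂ} (ha : IsBand e a) (hb : IsBand e b) :
    HasSum (fun q : (ι × ι) × ι => (a q.1.1 q.2 * b q.2 q.1.2) • N q.1.1 q.1.2)
      (bandSum N fun i l => ∑ᶠ k, a i k * b k l) := by
  have hrow : ∀ i l, (Function.support fun k => a i k * b k l).Finite := fun i l =>
    (ha.finite_row h i).subset fun k hk => left_ne_zero_of_mul hk
  obtain ⟨M, hM⟩ := id ha
  obtain ⟨M', hM'⟩ := id hb
  have hs : Summable fun q : (ι × ι) × ι =>
      (a q.1.1 q.2 * b q.2 q.1.2) • N q.1.1 q.1.2 := by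
    refine hN.summable (κ := (ι × ι) × ι) Prod.fst (fun q => a q.1.1 q.2 * b q.2 q.1.2)
      (M := M + M') (fun q hq => ?_) fun p => ?_
    · exact (abs_sub_le _ (e.deg q.2) _).trans
        (add_le_add (hM _ _ (left_ne_zero_of_mul hq)) (hM' _ _ (right_ne_zero_of_mul hq)))
    · refine ((hrow p.1 p.2).image fun k => (p, k)).subset ?_
      rintro ⟨q, k⟩ ⟨rfl, hk⟩
      exact ⟨k, hk, rfl⟩
  have h1 := hs.hasSum.prod_fiberwise (g := fun p => (∑ᶠ k, a p.1 k * b k p.2) • N p.1 p.2)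
    fun p => by
      rw [finsum_smul_of_finite (hrow p.1 p.2)]
      refine hasSum_finsum_of_finite ((hrow p.1 p.2).subset fun k hk h0 => hk ?_)
      change (a p.1 k * b k p.2) • N p.1 p.2 = 0
      rw [show a p.1 k * b k p.2 = 0 from h0, zero_smul]
  rw [bandSum, h1.tsum_eq]
  exact hs.hasSum

theorem VanishesAtInfinity.hasSum_mul_left (h : QuasiFinite 𝓛) {N : ι → ι → A}
    (hN : VanishesAtInfinity e N) {a b : ι → ι → ℂ} (ha : IsBand e a) (hb : IsBand e b) :
    HasSum (fun p : ι × ι => ∑ᶠ i, (a i p.1 * b p.1 p.2) • N i p.2)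
      (bandSum N fun i l => ∑ᶠ k, a i k * b k l) := by
  -- Exchanges `i` and `k` in the triple, so that the inner sum runs over the row index `i` with
  -- `(k, l)` fixed.
  let σ : (ι × ι) × ι ≃ (ι × ι) × ι :=
    { toFun := fun q => ((q.2, q.1.2), q.1.1)
      invFun := fun q => ((q.2, q.1.2), q.1.1)
      left_inv := fun _ => rfl
      right_inv := fun _ => rfl }
  refine (σ.hasSum_iff.2 (hN.hasSum_mul h ha hb)).prod_fiberwise fun p =>
    hasSum_finsum_of_finite ((ha.finite_col h p.1).subset fun i hi h0 => hi ?_)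
  change (a i p.1 * b p.1 p.2) • N i p.2 = 0
  rw [h0, zero_mul, zero_smul]

theorem VanishesAtInfinity.hasSum_mul_right (h : QuasiFinite 𝓛) {N : ι → ι → A}
    (hN : VanishesAtInfinity e N) {a b : ι → ι → ℂ} (ha : IsBand e a) (hb : IsBand e b) :
    HasSum (fun p : ι × ι => ∑ᶠ j, (a p.1 p.2 * b p.2 j) • N p.1 j)
      (bandSum N fun i l => ∑ᶠ k, a i k * b k l) := by
  -- Here the inner sum runs over the column index, with the entry of `a` fixed.
  let σ : (ι × ι) × ι ≃ (ι × ι) × ι :=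
    { toFun := fun q => ((q.1.1, q.2), q.1.2)
      invFun := fun q => ((q.1.1, q.2), q.1.2)
      left_inv := fun _ => rfl
      right_inv := fun _ => rfl }
  refine (σ.hasSum_iff.2 (hN.hasSum_mul h ha hb)).prod_fiberwise fun p =>
    hasSum_finsum_of_finite ((hb.finite_row h p.2).subset fun i hi h0 => hi ?_)
  change (a p.1 p.2 * b p.2 i) • N p.1 i = 0
  rw [h0, mul_zero, zero_smul]

variable [IsTopologicalRing A]
  {io : L →ₗ[ℂ] A} {ep : restrictedDual 𝓛 →ₗ[ℂ] A} {K : A}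

-- Multiplication by the fixed element `N k l` is continuous, so the commutator may be taken term by
-- term. The Kronecker symbols then confine the sum to one column of `a`, one row of `a` and one
-- entry, each of which is finite.
open Classical in
theorem IsClifford.commutator_bandSum_normalOrdered (h : QuasiFinite 𝓛)
    (hc : IsClifford io ep K) (hN : VanishesAtInfinity e (normalOrdered h e io ep))
    {a : ι → ι → ℂ} (ha : IsBand e a) (k l : ι) :
    bandSum (normalOrdered h e io ep) a * normalOrdered h e io ep k l -
        normalOrdered h e io ep k l * bandSum (normalOrdered h e io ep) a =
      K * (∑ᶠ i, a i k • normalOrdered h e io ep i l) -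
        K * (∑ᶠ j, a l j • normalOrdered h e io ep k j) +
        ((e.pos l - e.pos k) * a l k) • (K * K) := by
  set N := normalOrdered h e io ep with hNdef
  have hQ := hN.hasSum_bandSum ha
  have h1 := (hQ.mul_right (N k l)).sub (hQ.mul_left (N k l))
  have hfin : ∀ (c : ι → ℂ) (v : ι → A), {i | c i ≠ 0}.Finite →
      HasSum (fun i => c i • (K * v i)) (K * ∑ᶠ i, c i • v i) := fun c v hcf => by
    simp only [← mul_smul_comm]
    exact (hasSum_finsum_of_finite (hcf.subset fun i hi h0 => hi (by simp [h0]))).mul_left K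
  -- The condition `p.2 = k` makes this a sum over the image of `i ↦ (i, k)`.
  have h2 : HasSum (fun p : ι × ι => if p.2 = k then a p.1 p.2 • (K * N p.1 l) else 0)
      (K * ∑ᶠ i, a i k • N i l) := by
    have hinj : Function.Injective fun i : ι => (i, k) := fun i j hij => congrArg Prod.fst hij
    refine (hinj.hasSum_iff fun p hp => ?_).1 ?_
    · rw [if_neg]
      exact fun hpk => hp ⟨p.1, Prod.ext rfl hpk.symm⟩
    · simpa [Function.comp_def] using hfin (fun i => a i k) (fun i => N i l) (ha.finite_col h k)
  have h3 : HasSum (fun p : ι × ι => if p.1 = l then a p.1 p.2 • (K * N k p.2) else 0)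
      (K * ∑ᶠ j, a l j • N k j) := by
    have hinj : Function.Injective fun j : ι => (l, j) := fun i j hij => congrArg Prod.snd hij
    refine (hinj.hasSum_iff fun p hp => ?_).1 ?_
    · rw [if_neg]
      exact fun hpl => hp ⟨p.2, Prod.ext hpl.symm rfl⟩
    · simpa [Function.comp_def] using hfin (fun j => a l j) (fun j => N k j) (ha.finite_row h l)
  have h4 : HasSum (fun p : ι × ι => if p = (l, k) then
      ((e.pos l - e.pos k) * a l k) • (K * K) else 0)
      (((e.pos l - e.pos k) * a l k) • (K * K)) := hasSum_ite_eq _ _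
  refine h1.unique (((h2.sub h3).add h4).congr_fun fun p => ?_)
  obtain ⟨i, j⟩ := p
  rw [smul_mul_assoc, mul_smul_comm, ← smul_sub, hNdef, hc.commutator_normalOrdered h]
  by_cases hjk : j = k <;> by_cases hil : i = l
  · subst hjk hil
    simp only [if_true, and_self]
    module
  all_goals simp [hjk, hil, Prod.ext_iff]

/-- Expanding only the second factor avoids a fourfold sum: the commutator of `N(a)` with each `N k
l` is known, and it is summed against `b k l`. The column terms assemble to `N(ab)`, the row terms
to `N(ba)`, and the scalar terms to the cocycle. -/
theorem IsClifford.commutator_bandSum (h : QuasiFinite 𝓛)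
    (hc : IsClifford io ep K) (hN : VanishesAtInfinity e (normalOrdered h e io ep))
    {a b : ι → ι → ℂ} (ha : IsBand e a) (hb : IsBand e b) :
    bandSum (normalOrdered h e io ep) a * bandSum (normalOrdered h e io ep) b -
        bandSum (normalOrdered h e io ep) b * bandSum (normalOrdered h e io ep) a =
      K * (bandSum (normalOrdered h e io ep) (fun i l => ∑ᶠ k, a i k * b k l) -
        bandSum (normalOrdered h e io ep) (fun i l => ∑ᶠ k, b i k * a k l)) +
        bandCocycle e a b • (K * K) := by
  set N := normalOrdered h e io ep with hNdef
  have hQ := hN.hasSum_bandSum hb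
  have h1 := (hQ.mul_left (bandSum N a)).sub (hQ.mul_right (bandSum N a))
  have h2 := (hN.hasSum_mul_left h ha hb).mul_left K
  have h3 := (hN.hasSum_mul_right h hb ha).mul_left K
  have h4 : HasSum (fun p : ι × ι =>
      ((e.pos p.2 - e.pos p.1) * (a p.2 p.1 * b p.1 p.2)) • (K * K))
      (bandCocycle e a b • (K * K)) := by
    have hf := bandCocycle_support_finite h (a := a) hb
    rw [bandCocycle, finsum_smul_of_finite hf]
    exact hasSum_finsum_of_finite (hf.subset fun p hp h0 => hp (by
      change (_ * _) • _ = _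
      rw [show _ * _ = _ from h0, zero_smul]))
  rw [mul_sub]
  refine h1.unique (((h2.sub h3).add h4).congr_fun fun p => ?_)
  obtain ⟨k, l⟩ := p
  dsimp only
  have h5 : ∑ᶠ i, (a i k * b k l) • N i l = b k l • ∑ᶠ i, a i k • N i l := by
    rw [smul_finsum]
    simp only [smul_smul, mul_comm]
  have h6 : ∑ᶠ j, (b k l * a l j) • N k j = b k l • ∑ᶠ j, a l j • N k j := by
    rw [smul_finsum]
    simp only [smul_smul]
  rw [smul_mul_assoc, mul_smul_comm, ← smul_sub, hNdef,
    hc.commutator_bandSum_normalOrdered h hN ha, ← hNdef, h5, h6, mul_smul_comm, mul_smul_comm,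
    smul_add, smul_sub, smul_smul]
  congr 2
  ring

/-- The series `∑ :ι(ad x (e_j)) ε(e_j^*):` represent the Lie bracket up to a scalar. -/
theorem IsClifford.commutator_rhoTerm (h : QuasiFinite 𝓛) (hc : IsClifford io ep K)
    (hN : VanishesAtInfinity e (normalOrdered h e io ep)) (x y : L) :
    (∑' j, rhoTerm h e io ep x j) * (∑' j, rhoTerm h e io ep y j) -
        (∑' j, rhoTerm h e io ep y j) * (∑' j, rhoTerm h e io ep x j) =
      K * (∑' j, rhoTerm h e io ep ⁅x, y⁆ j) +
        bandCocycle e (adMatrix e x) (adMatrix e y) • (K * K) := by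
  have hx := isBand_adMatrix h e x
  have hy := isBand_adMatrix h e y
  rw [(hasSum_rhoTerm h hN x).tsum_eq, (hasSum_rhoTerm h hN y).tsum_eq,
    (hasSum_rhoTerm h hN ⁅x, y⁆).tsum_eq, hc.commutator_bandSum h hN hx hy]
  congr 2
  -- The matrix of `ad [x, y]` is the commutator of the two matrices, and both product sums converge
  -- separately.
  have h1 := (hN.hasSum_bandSum (hx.mul hy)).sub (hN.hasSum_bandSum (hy.mul hx))
  rw [← h1.tsum_eq, bandSum]
  simp only [adMatrix_lie, sub_smul]

end Summation

/-! ### The relations of `cl(L)` in the completed enveloping algebra of a Lie superalgebra -/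

section Completed

variable {V : Type*} [AddCommGroup V] [Module ℂ V] {S : GradedLieSuperalgebra V}

instance : NonarchimedeanRing (Env S) := Env.tail_basis.nonarchimedean

theorem EnvCom.of_mul_of {i j : ZMod 2} {x y : V} (hx : x ∈ S.par i) (hy : y ∈ S.par j) :
    EnvCom.of S x * EnvCom.of S y =
      koszul i j • (EnvCom.of S y * EnvCom.of S x) + EnvCom.of S (S.br x y) := by
  have h := congrArg (fun a : Env S => (a : EnvCom S)) (Env.of_mul_of hx hy)
  simp only [UniformSpace.Completion.coe_add, UniformSpace.Completion.coe_mul] at h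
  refine h.trans (congrArg (· + EnvCom.of S (S.br x y)) ?_)
  have hz : ∀ (n : ℤ) (a : Env S), ((n • a : Env S) : EnvCom S) = n • (a : EnvCom S) := fun n a =>
    map_zsmul (UniformSpace.Completion.toCompl (α := Env S)) n a
  rw [hz, UniformSpace.Completion.coe_mul]
  rfl

theorem Env.of_mem_degree {n : ℤ} {x : V} (hx : x ∈ S.gr n) : Env.of S x ∈ Env.degree S n := by
  obtain ⟨a, ha, b, hb, rfl⟩ := Submodule.mem_sup.1 (S.gr_le n hx)
  rw [map_add]
  exact add_mem
    (Submodule.subset_span ⟨1, by simpa using IsMonomial.mul ha.2 ha.1 IsMonomial.one⟩)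
    (Submodule.subset_span ⟨1, by simpa using IsMonomial.mul hb.2 hb.1 IsMonomial.one⟩)

theorem Env.mul_of_mem_tail {n N : ℤ} (hn : N ≤ n) (a : Env S) {x : V} (hx : x ∈ S.gr n) :
    a * Env.of S x ∈ Env.tail S N :=
  Submodule.smul_mem _ a (Submodule.subset_span ⟨n, hn, Env.of_mem_degree hx⟩)

/-- Since the basic neighbourhoods are complex subspaces, membership of a vector gives membership of
its whole line, as `VanishesAtInfinity` demands. -/
theorem Env.smul_mem_tail {N : ℤ} (c : ℂ) {a : Env S} (ha : a ∈ Env.tail S N) :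
    c • a ∈ Env.tail S N := by
  rw [Algebra.smul_def]
  exact Submodule.smul_mem _ _ ha

variable {L : Type*} [LieRing L] [LieAlgebra ℂ L] {𝓛 : ℤ → Submodule ℂ L}

/-- Graded maps `ι` and `ε` from `L` and `L^*` to the odd part of a Lie superalgebra, and an even
element `K`, that satisfy the relations of `cl(L)`. -/
structure IsCliffordIn (S : GradedLieSuperalgebra V) (io : L →ₗ[ℂ] V)
    (ep : restrictedDual 𝓛 →ₗ[ℂ] V) (K : V) : Prop where
  io_par : ∀ x, io x ∈ S.par 1
  ep_par : ∀ u, ep u ∈ S.par 1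
  K_par : K ∈ S.par 0
  io_gr : ∀ {n x}, x ∈ 𝓛 n → io x ∈ S.gr n
  ep_gr : ∀ {n} {u : restrictedDual 𝓛}, (u : Module.Dual ℂ L) ∈ dualGr 𝓛 n → ep u ∈ S.gr n
  br_io_io : ∀ x y, S.br (io x) (io y) = 0
  br_ep_ep : ∀ u v, S.br (ep u) (ep v) = 0
  br_io_ep : ∀ x u, S.br (io x) (ep u) = pairing 𝓛 u x • K
  br_K : ∀ v, S.br K v = 0

variable {io : L →ₗ[ℂ] V} {ep : restrictedDual 𝓛 →ₗ[ℂ] V} {K : V}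

theorem IsCliffordIn.isClifford (hc : IsCliffordIn S io ep K) :
    IsClifford (EnvCom.of S ∘ₗ io) (EnvCom.of S ∘ₗ ep) (EnvCom.of S K) := by
  have h11 : koszul 1 1 = -1 := by simp [koszul, ZMod.val_one]
  have h01 : koszul 0 1 = 1 := by simp [koszul]
  refine ⟨fun x y => ?_, fun u v => ?_, fun x u => ?_, fun x => ?_, fun u => ?_⟩
  · have := EnvCom.of_mul_of (hc.io_par x) (hc.io_par y)
    simpa [h11, hc.br_io_io] using this
  · have := EnvCom.of_mul_of (hc.ep_par u) (hc.ep_par v)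
    simpa [h11, hc.br_ep_ep] using this
  · have := EnvCom.of_mul_of (hc.io_par x) (hc.ep_par u)
    rw [h11, hc.br_io_ep, neg_one_smul, neg_add_eq_sub, map_smul] at this
    exact this
  · have := EnvCom.of_mul_of hc.K_par (hc.io_par x)
    simpa [h01, hc.br_K] using this
  · have := EnvCom.of_mul_of hc.K_par (hc.ep_par u)
    simpa [h01, hc.br_K] using this

variable {ι : Type*} [LinearOrder ι] {e : OrderedBasis 𝓛 ι}

theorem OrderedBasis.dual_mem (h : QuasiFinite 𝓛) (i : ι) :
    (e.dual h i : Module.Dual ℂ L) ∈ dualGr 𝓛 (-e.deg i) :=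
  fun _ hm _ hx => e.repr_eq_zero h hx (by simpa using hm.symm)

/-- If `e_j` has very negative degree, the rightmost factor `ε(e_j^*)` has large degree. If `e_j`
has large degree, so does `e_i` by the band condition, and `ι(e_i)` can be put on the right: by
normal ordering when `i = j`, and by anticommutation at no cost when `i ≠ j`. The bounds with `0`
and `1` fix the sign of `e.deg j`, which decides the form of the diagonal product. -/
theorem IsCliffordIn.normalOrdered_mem_tail (h : QuasiFinite 𝓛) (hc : IsCliffordIn S io ep K)
    {M N : ℤ} {i j : ι} (hij : |e.deg i - e.deg j| ≤ M)
    (hj : ¬(-max N 0 ≤ e.deg j ∧ e.deg j ≤ max (N + M) 1)) :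
    ∃ a ∈ Env.tail S N,
      normalOrdered h e (EnvCom.of S ∘ₗ io) (EnvCom.of S ∘ₗ ep) i j = (a : EnvCom S) := by
  have hab := abs_le.1 hij
  rcases not_and_or.1 hj with hlt | hgt
  · refine ⟨Env.of S (io (e.basis i)) * Env.of S (ep (e.dual h j)),
      Env.mul_of_mem_tail (n := -e.deg j) (by lia) _ (hc.ep_gr (e.dual_mem h j)), ?_⟩
    rw [normalOrdered, if_neg fun h0 => by lia, UniformSpace.Completion.coe_mul]
    rfl
  · refine ⟨-(Env.of S (ep (e.dual h j)) * Env.of S (io (e.basis i))),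
      neg_mem (Env.mul_of_mem_tail (n := e.deg i) (by lia) _ (hc.io_gr (e.mem i))), ?_⟩
    rw [UniformSpace.Completion.coe_neg, UniformSpace.Completion.coe_mul]
    by_cases hd : i = j
    · rw [normalOrdered, if_pos ⟨hd, by lia⟩]
      rfl
    · rw [normalOrdered, if_neg fun h0 => hd h0.1, hc.isClifford.io_ep, pairing_dual, if_neg hd,
        zero_smul, zero_sub]
      rfl

/-- A neighbourhood of zero contains the image of some `Env.tail S N`. The products in the band that
may lie outside that image have `e.deg j` in a bounded interval, and there are finitely many of
them. -/
theorem IsCliffordIn.vanishesAtInfinity (h : QuasiFinite 𝓛) (hc : IsCliffordIn S io ep K) :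
    VanishesAtInfinity e (normalOrdered h e (EnvCom.of S ∘ₗ io) (EnvCom.of S ∘ₗ ep)) := by
  intro M U hU
  have hpre : ((↑) : Env S → EnvCom S) ⁻¹' U ∈ 𝓝 (0 : Env S) :=
    (UniformSpace.Completion.continuous_coe (Env S)).continuousAt.preimage_mem_nhds
      (by rwa [UniformSpace.Completion.coe_zero])
  obtain ⟨N, -, hN⟩ := Env.tail_basis.hasBasis_nhds_zero.mem_iff.1 hpre
  refine (e.finite_near_pair h M (-max N 0) (max (N + M) 1)).subset ?_
  rintro ⟨i, j⟩ ⟨hij, c, hc'⟩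
  refine ⟨hij, ?_⟩
  by_contra hj
  obtain ⟨a, ha, hEq⟩ := hc.normalOrdered_mem_tail h hij hj
  apply hc'
  dsimp only
  rw [hEq, ← UniformSpace.Completion.coe_smul]
  exact hN (Env.smul_mem_tail c ha)

theorem IsCliffordIn.summable_rhoTerm (h : QuasiFinite 𝓛) (hc : IsCliffordIn S io ep K) (x : L) :
    Summable (rhoTerm h e (EnvCom.of S ∘ₗ io) (EnvCom.of S ∘ₗ ep) x) :=
  (hasSum_rhoTerm h (hc.vanishesAtInfinity h) x).summable

theorem EnvOne.mk_K : EnvOne.mk S K (EnvCom.of S K) = 1 := by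
  have : EnvOne.mk S K (EnvCom.of S K) = EnvOne.mk S K 1 :=
    RingQuot.mkAlgHom_rel ℂ (s := fun a b : EnvCom S => a = EnvCom.of S K ∧ b = 1) ⟨rfl, rfl⟩
  rw [this, map_one]

/-! ### The series in `U_1(S)^com` and its correction by `ϵ`. -/

/-- The image in `U_1(S)^com` of the series `∑ :ι(ad x (e_j)) ε(e_j^*):`. -/
def rhoSeries (S : GradedLieSuperalgebra V) (K : V) (io : L →ₗ[ℂ] V)
    (ep : restrictedDual 𝓛 →ₗ[ℂ] V) (h : QuasiFinite 𝓛) (e : OrderedBasis 𝓛 ι) (x : L) :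
    EnvOne S K :=
  EnvOne.mk S K (∑' j, rhoTerm h e (EnvCom.of S ∘ₗ io) (EnvCom.of S ∘ₗ ep) x j)

theorem IsCliffordIn.commutator_rhoSeries (h : QuasiFinite 𝓛) (hc : IsCliffordIn S io ep K)
    (x y : L) :
    rhoSeries S K io ep h e x * rhoSeries S K io ep h e y -
        rhoSeries S K io ep h e y * rhoSeries S K io ep h e x =
      rhoSeries S K io ep h e ⁅x, y⁆ +
        algebraMap ℂ _ (bandCocycle e (adMatrix e x) (adMatrix e y)) := by
  have := congrArg (EnvOne.mk S K)
    (hc.isClifford.commutator_rhoTerm h (hc.vanishesAtInfinity (e := e) h) x y)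
  rw [map_sub, map_mul, map_mul, map_add, map_mul, map_smul, map_mul, EnvOne.mk_K, one_mul,
    one_mul, ← Algebra.algebraMap_eq_smul_one] at this
  exact this

theorem rhoTerm_add {A : Type*} [Ring A] [Algebra ℂ A] (h : QuasiFinite 𝓛) (io : L →ₗ[ℂ] A)
    (ep : restrictedDual 𝓛 →ₗ[ℂ] A) (x y : L) (j : ι) :
    rhoTerm h e io ep (x + y) j = rhoTerm h e io ep x j + rhoTerm h e io ep y j := by
  rw [rhoTerm, add_lie, map_add]
  exact Finsupp.sum_add_index' (fun _ => zero_smul ℂ _) fun _ _ _ => add_smul _ _ _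

theorem rhoTerm_smul {A : Type*} [Ring A] [Algebra ℂ A] (h : QuasiFinite 𝓛) (io : L →ₗ[ℂ] A)
    (ep : restrictedDual 𝓛 →ₗ[ℂ] A) (c : ℂ) (x : L) (j : ι) :
    rhoTerm h e io ep (c • x) j = c • rhoTerm h e io ep x j := by
  rw [rhoTerm, smul_lie, map_smul, rhoTerm, Finsupp.smul_sum]
  refine (Finsupp.sum_smul_index' fun i => zero_smul ℂ (normalOrdered h e io ep i j)).trans ?_
  simp only [smul_assoc]

theorem IsCliffordIn.rhoSeries_add (h : QuasiFinite 𝓛) (hc : IsCliffordIn S io ep K) (x y : L) :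
    rhoSeries S K io ep h e (x + y) =
      rhoSeries S K io ep h e x + rhoSeries S K io ep h e y := by
  simp only [rhoSeries, rhoTerm_add]
  rw [(hc.summable_rhoTerm h x).tsum_add (hc.summable_rhoTerm h y), map_add]

theorem IsCliffordIn.rhoSeries_smul (h : QuasiFinite 𝓛) (hc : IsCliffordIn S io ep K) (c : ℂ)
    (x : L) : rhoSeries S K io ep h e (c • x) = c • rhoSeries S K io ep h e x := by
  simp only [rhoSeries, rhoTerm_smul]
  rw [(hc.summable_rhoTerm h x).tsum_const_smul, map_smul]

/-- An even element that commutes with `ι(L)` and `ε(L^*)` commutes with the series. -/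
theorem IsCliffordIn.commute_rhoSeries (h : QuasiFinite 𝓛) (hc : IsCliffordIn S io ep K) {v : V}
    (hv : v ∈ S.par 0) (hio : ∀ x, S.br v (io x) = 0) (hep : ∀ u, S.br v (ep u) = 0) (x : L) :
    Commute (EnvOne.mk S K (EnvCom.of S v)) (rhoSeries S K io ep h e x) := by
  have h01 : koszul 0 1 = 1 := by simp [koszul]
  have h1 : ∀ x, Commute (EnvCom.of S v) ((EnvCom.of S ∘ₗ io) x) := fun x => by
    have := EnvCom.of_mul_of hv (hc.io_par x)
    rwa [h01, hio, one_smul, map_zero, add_zero] at this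
  have h2 : ∀ u, Commute (EnvCom.of S v) ((EnvCom.of S ∘ₗ ep) u) := fun u => by
    have := EnvCom.of_mul_of hv (hc.ep_par u)
    rwa [h01, hep, one_smul, map_zero, add_zero] at this
  have h3 : ∀ j, Commute (EnvCom.of S v)
      (rhoTerm h e (EnvCom.of S ∘ₗ io) (EnvCom.of S ∘ₗ ep) x j) := fun j => by
    refine Commute.sum_right _ _ _ fun i _ => Commute.smul_right ?_ _
    rw [normalOrdered]
    split_ifs
    · exact ((h2 _).mul_right (h1 _)).neg_right
    · exact (h1 _).mul_right (h2 _)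
  exact (Commute.tsum_right _ h3).map (EnvOne.mk S K)

/-- The cancellation behind `ρ̄^β`, free of any series: `r`, `s` have defect `k`, the elements `u`,
`v` commute with them and contribute `-(k - d)`, and the scalars `b`, `c` are central. What survives
is `d`, which becomes `β([x, y])`. -/
theorem commutator_add_algebraMap_add {A : Type*} [Ring A] [Algebra ℂ A] {r s t u v : A}
    {k d : ℂ} (hrs : r * s - s * r = t + algebraMap ℂ A k)
    (huv : u * v = v * u - algebraMap ℂ A (k - d)) (hvr : v * r = r * v) (hus : u * s = s * u)
    (b c : ℂ) :
    (r + algebraMap ℂ A b + u) * (s + algebraMap ℂ A c + v) -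
        (s + algebraMap ℂ A c + v) * (r + algebraMap ℂ A b + u) = t + algebraMap ℂ A d := by
  rw [sub_eq_iff_eq_add] at hrs
  simp only [add_mul, mul_add, hrs, huv, hvr, hus, map_sub, Algebra.commutes b s,
    Algebra.commutes b v, Algebra.commutes b (algebraMap ℂ A c), Algebra.commutes c r,
    Algebra.commutes c u]
  abel

theorem algebraMap_mul_eq_smul {A : Type*} [Ring A] [Algebra ℂ A] (c b : ℂ) :
    algebraMap ℂ A (c * b) = c • algebraMap ℂ A b := by
  rw [map_mul, ← Algebra.smul_def]

/-- The series, corrected by `β` and by a map `ϵ` that compensates the cocycle, as a homomorphism of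
Lie algebras. -/
def IsCliffordIn.lieHom (h : QuasiFinite 𝓛) (e : OrderedBasis 𝓛 ι) (hc : IsCliffordIn S io ep K)
    (β : Module.Dual ℂ L) (ε : L →ₗ[ℂ] V) (hpar : ∀ x, ε x ∈ S.par 0)
    (hio : ∀ x y, S.br (ε x) (io y) = 0) (hep : ∀ x u, S.br (ε x) (ep u) = 0)
    (hε : ∀ x y, S.br (ε x) (ε y) =
      -(bandCocycle e (adMatrix e x) (adMatrix e y) - β ⁅x, y⁆) • K)
    (hlie : ∀ x y : L, ε ⁅x, y⁆ = 0) : L →ₗ⁅ℂ⁆ EnvOne S K where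
  toFun x := rhoSeries S K io ep h e x + algebraMap ℂ _ (β x) + EnvOne.mk S K (EnvCom.of S (ε x))
  map_add' x y := by
    rw [hc.rhoSeries_add, map_add, map_add, map_add, map_add, map_add]
    abel
  map_smul' c x := by
    rw [hc.rhoSeries_smul, map_smul β, map_smul ε, map_smul (EnvCom.of S),
      map_smul (EnvOne.mk S K), smul_eq_mul, algebraMap_mul_eq_smul, RingHom.id_apply, smul_add,
      smul_add]
  map_lie' {x y} := by
    have hcomm := fun x y => (hc.commute_rhoSeries (e := e) h (hpar y) (hio y) (hep y) x).eq
    have hE := EnvCom.of_mul_of (hpar x) (hpar y)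
    rw [hε, show koszul 0 0 = 1 by simp [koszul], one_smul, map_smul] at hE
    have hE' := congrArg (EnvOne.mk S K) hE
    rw [map_mul, map_add, map_mul, map_smul, EnvOne.mk_K, neg_smul, ← sub_eq_add_neg,
      ← Algebra.algebraMap_eq_smul_one] at hE'
    -- The image of `[x, y]` carries no `ϵ`-term, and this is where the condition on brackets
    -- enters.
    rw [LieRing.of_associative_ring_bracket, hlie, map_zero, map_zero, add_zero]
    exact (commutator_add_algebraMap_add (hc.commutator_rhoSeries h x y) hE' (hcomm x y)
      (hcomm y x) (β x) (β y)).symm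

end Completed

/-! ### The cocycle and the Lie algebra homomorphism -/

section Main

variable {L : Type*} [LieRing L] [LieAlgebra ℂ L] {𝓛 : ℤ → Submodule ℂ L}
  {ι : Type*} [LinearOrder ι] {e : OrderedBasis 𝓛 ι}

theorem isCliffordIn_cl (h : QuasiFinite 𝓛) :
    IsCliffordIn (clLie h) (LinearMap.inl ℂ _ _ ∘ₗ LinearMap.inl ℂ L (restrictedDual 𝓛))
      (LinearMap.inl ℂ _ _ ∘ₗ LinearMap.inr ℂ L (restrictedDual 𝓛)) (clK 𝓛) where
  io_par _ := mem_clPar_one.2 rfl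
  ep_par _ := mem_clPar_one.2 rfl
  K_par := mem_clPar_zero.2 rfl
  io_gr hx := ⟨⟨hx, zero_mem _⟩, zero_mem _⟩
  ep_gr hu := ⟨⟨zero_mem _, hu⟩, zero_mem _⟩
  br_io_io x y := by simp [clLie]
  br_ep_ep u v := by simp [clLie]
  br_io_ep x u := by simp [clLie, clK]
  br_K v := by simp [clLie, clK]

theorem isCliffordIn_c (h : QuasiFinite 𝓛) {γ : GradedAltForm 𝓛} (C : GradedComplement γ) :
    IsCliffordIn (cLie h C)
      (LinearMap.inl ℂ _ _ ∘ₗ LinearMap.inl ℂ _ _ ∘ₗ LinearMap.inl ℂ L (restrictedDual 𝓛))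
      (LinearMap.inl ℂ _ _ ∘ₗ LinearMap.inl ℂ _ _ ∘ₗ LinearMap.inr ℂ L (restrictedDual 𝓛))
      (cK C) where
  io_par _ := mem_cPar_one.2 ⟨rfl, rfl⟩
  ep_par _ := mem_cPar_one.2 ⟨rfl, rfl⟩
  K_par := mem_cPar_zero.2 rfl
  io_gr hx := ⟨⟨⟨hx, zero_mem _⟩, zero_mem _⟩, zero_mem _⟩
  ep_gr hu := ⟨⟨⟨zero_mem _, hu⟩, zero_mem _⟩, zero_mem _⟩
  br_io_io x y := by simp [cLie]
  br_ep_ep u v := by simp [cLie]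
  br_io_ep x u := by simp [cLie, clK, cK]
  br_K v := by simp [cLie, clK, cK]

theorem rho_eq (h : QuasiFinite 𝓛) (β : Module.Dual ℂ L) (x : L) :
    rho h e β x = rhoSeries (clLie h) (clK 𝓛)
      (LinearMap.inl ℂ _ _ ∘ₗ LinearMap.inl ℂ L (restrictedDual 𝓛))
      (LinearMap.inl ℂ _ _ ∘ₗ LinearMap.inr ℂ L (restrictedDual 𝓛)) h e x +
        algebraMap ℂ _ (β x) := rfl

theorem rho_add (h : QuasiFinite 𝓛) (β : Module.Dual ℂ L) (x y : L) :
    rho h e β (x + y) = rho h e β x + rho h e β y := by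
  rw [rho_eq, rho_eq, rho_eq, (isCliffordIn_cl h).rhoSeries_add, map_add, map_add]
  abel

theorem rho_smul (h : QuasiFinite 𝓛) (β : Module.Dual ℂ L) (c : ℂ) (x : L) :
    rho h e β (c • x) = c • rho h e β x := by
  rw [rho_eq, rho_eq, (isCliffordIn_cl h).rhoSeries_smul, map_smul, smul_add, smul_eq_mul, map_mul,
    ← Algebra.smul_def]

/-- The scalars `β(x)` and `β(y)` are central and disappear from the commutator, so `β` enters only
through `ρ^β([x, y])` and changes the cocycle by a coboundary. -/
theorem gammaElement_eq (h : QuasiFinite 𝓛) (e : OrderedBasis 𝓛 ι) (β : Module.Dual ℂ L)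
    (x y : L) :
    gammaElement h e β x y =
      algebraMap ℂ _ (bandCocycle e (adMatrix e x) (adMatrix e y) - β ⁅x, y⁆) := by
  have := (isCliffordIn_cl h).commutator_rhoSeries (e := e) h x y
  rw [sub_eq_iff_eq_add] at this
  simp only [gammaElement, rho_eq, add_mul, mul_add, map_sub, this,
    Algebra.commutes (β x) (rhoSeries _ _ _ _ h e y),
    ← Algebra.commutes (β y) (rhoSeries _ _ _ _ h e x),
    ← Algebra.commutes (β x) (algebraMap ℂ (EnvOne (clLie h) (clK 𝓛)) (β y))]
  abel

theorem vacuumForm_ne_zero : (vacuumForm : Forms e) ≠ 0 := (monomial e).ne_zero _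

/-- The action on semi-infinite forms shows that the quotient by `K - 1` does not collapse: a scalar
acts on the nonzero vacuum form as itself. Hence a scalar element determines its scalar. -/
theorem algebraMap_clOne_injective (h : QuasiFinite 𝓛) (e : OrderedBasis 𝓛 ι) :
    Function.Injective (algebraMap ℂ (EnvOne (clLie h) (clK 𝓛))) := by
  intro a b hab
  have := congrArg (fun T => clAct h e T vacuumForm) hab
  simp only [AlgHom.commutes, Module.algebraMap_end_apply] at this
  exact smul_left_injective ℂ vacuumForm_ne_zero this

/-- The cocycle `γ^β` in terms of the structure constants of `L`. -/
theorem exists_gamma (h : QuasiFinite 𝓛) (e : OrderedBasis 𝓛 ι) (β : Module.Dual ℂ L)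
    (hβ : β ∈ dualGr 𝓛 0) :
    ∃ γ : GradedAltForm 𝓛, ∀ x y, gammaElement h e β x y = algebraMap ℂ _ (γ.form x y) := by
  have hinj := algebraMap_clOne_injective h e
  -- By injectivity, an identity between scalars may be checked in `U_1(cl(L))^com`. Bilinearity and
  -- alternation thus follow from the commutator expression, without manipulating the sum in
  -- `bandCocycle`.
  have hval : ∀ {x y : L} {c : ℂ}, gammaElement h e β x y = algebraMap ℂ _ c →
      bandCocycle e (adMatrix e x) (adMatrix e y) - β ⁅x, y⁆ = c := fun hxy =>
    hinj ((gammaElement_eq h e β _ _).symm.trans hxy)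
  refine ⟨⟨LinearMap.mk₂ ℂ
    (fun x y => bandCocycle e (adMatrix e x) (adMatrix e y) - β ⁅x, y⁆) ?_ ?_ ?_ ?_, ?_, ?_⟩,
    gammaElement_eq h e β⟩
  · intro x x' y
    refine hval ?_
    rw [map_add, ← gammaElement_eq, ← gammaElement_eq]
    simp only [gammaElement, add_lie, rho_add, add_mul, mul_add]
    abel
  · intro c x y
    refine hval ?_
    rw [smul_eq_mul, map_mul, ← gammaElement_eq, ← Algebra.smul_def]
    simp only [gammaElement, smul_lie, rho_smul, smul_mul_assoc, mul_smul_comm, smul_sub]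
  · intro x y y'
    refine hval ?_
    rw [map_add, ← gammaElement_eq, ← gammaElement_eq]
    simp only [gammaElement, lie_add, rho_add, add_mul, mul_add]
    abel
  · intro c x y
    refine hval ?_
    rw [smul_eq_mul, map_mul, ← gammaElement_eq, ← Algebra.smul_def]
    simp only [gammaElement, lie_smul, rho_smul, smul_mul_assoc, mul_smul_comm, smul_sub]
  · intro x
    refine hval ?_
    -- Homogeneity with the scalar `0` shows that `ρ^β(0) = 0`.
    have h0 := rho_smul (e := e) h β 0 0
    rw [zero_smul, zero_smul] at h0
    rw [gammaElement, lie_self, h0, sub_self, sub_zero, map_zero]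
  · intro m n x y hx hy hmn
    -- The cocycle vanishes by degree, and `β` of degree zero kills the bracket, which has degree `m
    -- + n ≠ 0`.
    rw [LinearMap.mk₂_apply, bandCocycle_adMatrix_eq_zero h hx hy hmn,
      hβ _ (by simpa using hmn) _ (h.lie_mem hx hy), sub_zero]

/-- By `exists_gamma` the definition of `gamma` takes its chosen form and not the default `0`. -/
theorem gammaElement_eq_gamma (h : QuasiFinite 𝓛) (e : OrderedBasis 𝓛 ι) {β : Module.Dual ℂ L}
    (hβ : β ∈ dualGr 𝓛 0) (x y : L) :
    gammaElement h e β x y = algebraMap ℂ _ ((gamma h e β).form x y) := by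
  have H := exists_gamma h e β hβ
  rw [gamma, dif_pos H]
  exact H.choose_spec x y

theorem gamma_form (h : QuasiFinite 𝓛) (e : OrderedBasis 𝓛 ι) {β : Module.Dual ℂ L}
    (hβ : β ∈ dualGr 𝓛 0) (x y : L) :
    (gamma h e β).form x y = bandCocycle e (adMatrix e x) (adMatrix e y) - β ⁅x, y⁆ :=
  algebraMap_clOne_injective h e
    ((gammaElement_eq_gamma h e hβ x y).symm.trans (gammaElement_eq h e β x y))

/-! ### Projection to a complement of the radical. -/

section Complement

variable {γ : GradedAltForm 𝓛} (C : GradedComplement γ)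

theorem GradedComplement.eps_par (x : L) : C.eps x ∈ cPar C 0 := mem_cPar_zero.2 rfl

theorem GradedComplement.eps_of_mem_ker {x : L} (hx : x ∈ LinearMap.ker γ.form) :
    C.eps x = 0 := by
  rw [GradedComplement.eps, LinearMap.comp_apply,
    (Submodule.projectionOnto_apply_eq_zero_iff C.isCompl).2 hx, map_zero]

/-- An element and its projection differ by an element of the radical, which is invisible to the
form in the first argument; antisymmetry gives the second. -/
theorem GradedComplement.form_eps (x y : L) : γ.form (C.eps x).2 (C.eps y).2 = γ.form x y := by
  have hker : ∀ x : L, x - (C.eps x).2 ∈ LinearMap.ker γ.form := fun x => by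
    rw [← Submodule.projectionOnto_apply_eq_zero_iff C.isCompl, map_sub]
    exact sub_eq_zero.2 (Submodule.projectionOnto_apply_left C.isCompl _).symm
  have h1 : ∀ x z : L, γ.form (C.eps x).2 z = γ.form x z := fun x z => by
    have := LinearMap.congr_fun (LinearMap.mem_ker.1 (hker x)) z
    rw [map_sub, LinearMap.sub_apply, LinearMap.zero_apply, sub_eq_zero] at this
    exact this.symm
  rw [h1, γ.neg, h1, ← γ.neg]

theorem GradedComplement.br_eps (h : QuasiFinite 𝓛) (x y : L) :
    (cLie h C).br (C.eps x) (C.eps y) = -γ.form x y • cK C := by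
  have h1 : (cLie h C).br (C.eps x) (C.eps y) =
      -γ.form (C.eps x).2 (C.eps y).2 • cK C := by
    refine (cBr_apply C _ _).trans (Prod.ext ?_ (smul_zero _).symm)
    change clBr 𝓛 (0 : ClSpace 𝓛) (0 : ClSpace 𝓛) - _ • clK 𝓛 = -_ • clK 𝓛
    rw [map_zero, zero_sub]
    exact (neg_smul _ _).symm
  rw [h1, C.form_eps]

end Complement

/-- The homomorphism `ρ̄^β`. -/
def rhoBarHom (h : QuasiFinite 𝓛) {β : Module.Dual ℂ L} (hβ : β ∈ dualGr 𝓛 0)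
    (C : GradedComplement (gamma h e β))
    (hker : ∀ x y : L, ⁅x, y⁆ ∈ LinearMap.ker (gamma h e β).form) :
    L →ₗ⁅ℂ⁆ EnvOne (cLie h C) (cK C) :=
  (isCliffordIn_c h C).lieHom h e β C.eps C.eps_par
    (fun x y => by simp [cLie, GradedComplement.eps])
    (fun x u => by simp [cLie, GradedComplement.eps])
    (fun x y => by rw [C.br_eps, gamma_form h e hβ])
    (fun x y => C.eps_of_mem_ker (hker x y))

theorem rhoBarHom_apply (h : QuasiFinite 𝓛) {β : Module.Dual ℂ L} (hβ : β ∈ dualGr 𝓛 0)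
    (C : GradedComplement (gamma h e β))
    (hker : ∀ x y : L, ⁅x, y⁆ ∈ LinearMap.ker (gamma h e β).form) (x : L) :
    rhoBarHom h hβ C hker x = rhoBar h e β C x := rfl

/-! ### Module structures and their obstruction. -/

theorem exists_lieModule_of_lieHom {A M : Type*} [Ring A] [Algebra ℂ A] [AddCommGroup M]
    [Module ℂ M] (f : L →ₗ⁅ℂ⁆ A) (φ : A →ₐ[ℂ] Module.End ℂ M) :
    ∃ (_ : LieRingModule L M) (_ : LieModule ℂ L M), ∀ (x : L) (m : M), ⁅x, m⁆ = φ (f x) m := by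
  let inst : LieRingModule L M :=
    { bracket := fun x m => φ (f x) m
      add_lie := fun x y m => by
        rw [map_add, map_add, LinearMap.add_apply]
      lie_add := fun x m m' => map_add (φ (f x)) m m'
      leibniz_lie := fun x y m => by
        change φ (f x) (φ (f y) m) = φ (f ⁅x, y⁆) m + φ (f y) (φ (f x) m)
        rw [LieHom.map_lie, LieRing.of_associative_ring_bracket, map_sub, map_mul, map_mul]
        simp }
  refine ⟨inst, ⟨fun c x m => ?_, fun c x m => ?_⟩, fun x m => rfl⟩
  · change φ (f (c • x)) m = c • φ (f x) m
    rw [map_smul, map_smul, LinearMap.smul_apply]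
  · exact map_smul (φ (f x)) c m

/-- In a module the operators of `ρ^β` respect brackets, so the scalar defect acts by zero; on the
nonzero vacuum form this forces it to vanish. Only the Leibniz rule of the action is used, not its
compatibility with scalars. -/
theorem gamma_eq_zero_of_lieModule (h : QuasiFinite 𝓛) {β : Module.Dual ℂ L}
    (hβ : β ∈ dualGr 𝓛 0) [LieRingModule L (Forms e)]
    (hact : ∀ (x : L) (m : Forms e), ⁅x, m⁆ = clAct h e (rho h e β x) m) (x y : L) :
    (gamma h e β).form x y = 0 := by
  have h1 := congrArg (fun T => clAct h e T vacuumForm) (gammaElement_eq_gamma h e hβ x y)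
  simp only [gammaElement, map_sub, map_mul, LinearMap.sub_apply, Module.End.mul_apply, ← hact,
    AlgHom.commutes, Module.algebraMap_end_apply] at h1
  rw [← lie_lie, sub_self] at h1
  exact (smul_eq_zero.1 h1.symm).resolve_right vacuumForm_ne_zero

end Main

end SemiInfinite

end

open SemiInfinite TensorProduct in
theorem mainTheorem2 {L : Type*} [LieRing L] [LieAlgebra ℂ L] {𝓛 : ℤ → Submodule ℂ L}
    (h : QuasiFinite 𝓛) {ι : Type*} [LinearOrder ι] (e : OrderedBasis 𝓛 ι)
    (β : Module.Dual ℂ L) (_hβ : β ∈ dualGr 𝓛 0) :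
    -- the series that defines `ρ^β(x)` converges in `U(cl(L))^com`
    (∀ x, Summable (clTerm h e x)) ∧
    -- `[ρ^β(x), ρ^β(y)] - ρ^β([x, y])` is the scalar `γ^β(x, y)`
    (∀ x y, rho h e β x * rho h e β y - rho h e β y * rho h e β x - rho h e β ⁅x, y⁆ =
      algebraMap ℂ _ ((gamma h e β).form x y)) ∧
    -- for every graded complement of the radical of `γ^β`
    (∀ C : GradedComplement (gamma h e β),
      -- the series that defines `ρ^β(x)` converges in `U(c(L))^com`
      (∀ x, Summable (cTerm h e C x)) ∧
      ((∀ x y : L, ⁅x, y⁆ ∈ LinearMap.ker (gamma h e β).form) →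
        -- `x ↦ ρ̄^β(x)` is a homomorphism of Lie algebras to `U_1(c(L))^com`
        (∃ f : L →ₗ⁅ℂ⁆ EnvOne (cLie h C) (cK C), ∀ x, f x = rhoBar h e β C x) ∧
        -- `Λ^{∞/2 + •} L^* ⊗ 𝔉_β` is an `L`-module under `ρ̄^β`
        (∃ (_ : LieRingModule L (Forms e ⊗[ℂ] Fock C)) (_ : LieModule ℂ L (Forms e ⊗[ℂ] Fock C)),
          ∀ (x : L) (m : Forms e ⊗[ℂ] Fock C), ⁅x, m⁆ = cAct h e C (rhoBar h e β C x) m))) ∧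
    -- `Λ^{∞/2 + •} L^*` is not an `L`-module under `ρ^β` if `γ^β` is not identically zero
    ((∃ x y, (gamma h e β).form x y ≠ 0) →
      ¬ ∃ (_ : LieRingModule L (Forms e)) (_ : LieModule ℂ L (Forms e)),
        ∀ (x : L) (m : Forms e), ⁅x, m⁆ = clAct h e (rho h e β x) m) := by
  refine ⟨(isCliffordIn_cl h).summable_rhoTerm h, gammaElement_eq_gamma h e _hβ, fun C =>
    ⟨(isCliffordIn_c h C).summable_rhoTerm h, fun hker =>
      ⟨⟨rhoBarHom h _hβ C hker, rhoBarHom_apply h _hβ C hker⟩,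
        exists_lieModule_of_lieHom (rhoBarHom h _hβ C hker) (cAct h e C)⟩⟩, ?_⟩
  rintro ⟨x, y, hxy⟩ ⟨_, _, hact⟩
  exact hxy (gamma_eq_zero_of_lieModule h _hβ hact x y)
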